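/- Let $\mathbb D$ be the unit disc, $\mathbb T$ the unit circle, $m$ the normalized arc length on $\mathbb T$ and $dA=\frac{dx\,dy}{\pi}$. Let $\omega:\mathbb D\to[0,\infty]$ be a positive superharmonic weight, that is, $\omega$ is superharmonic (lower semicontinuous, not identically $\infty$, and $\omega(a)\ge\frac1{2\pi}\int_0^{2\pi}\omega(a+re^{i\theta})\,d\theta$ whenever $\{|z-a|\le r\}\subset\mathbb D$, $r>0$) and integrable with respect to area measure on $\mathbb D$. For $f$ holomorphic on $\mathbb D$ put $$\mathcal D_\omega(f)=\int_{\mathbb D}|f'(z)|^2\,\omega(z)\,dA(z)\in[0,\infty].$$ An outer function is a function $f$ in the Hardy space $H^1$ of the form $$f(z)=\alpha\exp\left(\int_{\mathbb T}\frac{\zeta+z}{\zeta-z}\,h(\zeta)\,dm(\zeta)\right),\qquad z\in\mathbb D,$$ with $|\alpha|=1$ and $h$ a real-valued integrable function on $\mathbb T$. For a function $f$ in a Hardy space write $f^*(\zeta)=\lim_{r\to1^-}f(r\zeta)$, which exists for $m$-almost every $\zeta\in\mathbb T$. For outer functions $f,g$ define, for $z\in\mathbb D$, $$(f\wedge g)(z)=\exp\left(\int_{\mathbb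 T}\frac{\zeta+z}{\zeta-z}\log\min(|f^*(\zeta)|,|g^*(\zeta)|)\,dm(\zeta)\right),$$ $$(f\vee g)(z)=\exp\left(\int_{\mathbb T}\frac{\zeta+z}{\zeta-z}\log\max(|f^*(\zeta)|,|g^*(\zeta)|)\,dm(\zeta)\right).$$ Let $f$ and $g$ be outer functions in the Hardy space $H^2$. Then, as inequalities in $[0,\infty]$, (A) $\mathcal D_\omega(f\vee g)\le\mathcal D_\omega(f)+\mathcal D_\omega(g)$; (B) $\mathcal D_\omega(f\wedge g)\le\mathcal D_\omega(f)+\mathcal D_\omega(g)$; (C) $\mathcal D_\omega(f\wedge f^2)\le4\,\mathcal D_\omega(f)$. -/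

import Mathlib

open scoped ENNReal

/-- A superharmonic function `ω : U → [0, ∞]` on an open set `U ⊆ ℂ`: lower semicontinuous,
finite somewhere, and with the super-mean value property on circles.
Values of `ω` outside `U` play no role. -/
structure IsPosSuperharmonicOn (ω : ℂ → ℝ≥0∞) (U : Set ℂ) : Prop where
  lowerSemicontinuousOn : LowerSemicontinuousOn ω U
  finite_somewhere : ∃ z ∈ U, ω z ≠ ∞
  circle_mean_le : ∀ a : ℂ, ∀ r : ℝ, 0 < r → Metric.closedBall a r ⊆ U →
    (∫⁻ θ in Set.Ioc 0 (2 * Real.pi), ω (circleMap a r θ)) / ENNReal.ofReal (2 * Real.pi) ≤ ω a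

/-- A positive superharmonic weight on the unit disc: a positive superharmonic function that is
integrable with respect to area measure. -/
structure IsSuperharmonicWeight (ω : ℂ → ℝ≥0∞) : Prop where
  superharmonic : IsPosSuperharmonicOn ω (Metric.ball 0 1)
  integrable : ∫⁻ z in Metric.ball (0 : ℂ) 1, ω z < ∞

/-- The Dirichlet integral `D_ω(f) = ∫_𝔻 |f'|² ω dA`, with `dA = dx dy / π`, valued in `[0, ∞]`. -/
noncomputable def dirichletIntegral (ω : ℂ → ℝ≥0∞) (f : ℂ → ℂ) : ℝ≥0∞ :=
  (∫⁻ z in Metric.ball (0 : ℂ) 1, ‖deriv f z‖ₑ ^ 2 * ω z) / ENNReal.ofReal Real.pi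

/-- The Hardy space `H^p` of the unit disc: holomorphic functions with bounded `p`-th integral
means over the circles of radius `r < 1`. -/
def MemHardy (p : ℝ) (f : ℂ → ℂ) : Prop :=
  DifferentiableOn ℂ f (Metric.ball 0 1) ∧
    ∃ C : ℝ, ∀ r ∈ Set.Ioo (0 : ℝ) 1, Real.circleAverage (fun z => ‖f z‖ ^ p) 0 r ≤ C

/-- `exp (∫_𝕋 (ζ + z) / (ζ - z) h(ζ) dm(ζ))`, with `m` normalized arc length on the circle. -/
noncomputable def outerExp (h : ℂ → ℝ) (z : ℂ) : ℂ :=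
  Complex.exp (Real.circleAverage (fun ζ => (ζ + z) / (ζ - z) * (h ζ : ℂ)) 0 1)

/-- Outer functions: functions in `H¹` of the form
`α exp (∫_𝕋 (ζ + z) / (ζ - z) h(ζ) dm(ζ))` on the unit disc, with `h` real-valued and integrable
on the circle and `|α| = 1`. -/
def IsOuter (f : ℂ → ℂ) : Prop :=
  MemHardy 1 f ∧ ∃ (α : ℂ) (h : ℂ → ℝ), ‖α‖ = 1 ∧ CircleIntegrable h 0 1 ∧
    ∀ z ∈ Metric.ball (0 : ℂ) 1, f z = α * outerExp h z

/-- The boundary function `f*(ζ) = lim_{r → 1⁻} f(rζ)`, which exists for almost every `ζ` on the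
circle when `f` lies in a Hardy space. -/
noncomputable def radialLimit (f : ℂ → ℂ) (ζ : ℂ) : ℂ :=
  Filter.limUnder (nhdsWithin (1 : ℝ) (Set.Iio 1)) (fun r : ℝ => f ((r : ℂ) * ζ))

/-- The cut-off `f ∧ g`, the outer function with boundary modulus `min(|f*|, |g*|)`. -/
noncomputable def outerInf (f g : ℂ → ℂ) : ℂ → ℂ :=
  outerExp (fun ζ => Real.log (min ‖radialLimit f ζ‖ ‖radialLimit g ζ‖))

/-- The cut-off `f ∨ g`, the outer function with boundary modulus `max(|f*|, |g*|)`. -/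
noncomputable def outerSup (f g : ℂ → ℂ) : ℂ → ℂ :=
  outerExp (fun ζ => Real.log (max ‖radialLimit f ζ‖ ‖radialLimit g ζ‖))

/-!
If `u`, `v` are holomorphic on the disc with values in a Hilbert space, `‖u‖ ≤ ‖v‖`, and the means
of `‖u‖²` and `‖v‖²` over the circle of radius `r` have the same limit as `r → 1`, then
`∫ ‖v'‖² ω ≤ ∫ ‖u'‖² ω`. Indeed `‖v‖² - ‖u‖²` is nonnegative, vanishes on the boundary and has
Laplacian `4 (‖v'‖² - ‖u'‖²)`, so Green's formula turns the difference of the two integrals into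
the integral of `‖v‖² - ‖u‖²` against the negative measure `Δω`. As `ω` is not smooth, the
Laplacian is replaced by means over small circles.

For (A) and (B) take `u = (f, g)` and `v = (f ∨ g, f ∧ g)`; up to a unimodular constant
`(f ∨ g) (f ∧ g)` is `f g`, and `‖u‖ ≤ ‖v‖` follows. For (C) put `m = f ∧ 1`, `k = f ∨ 1`, so that
`f ∧ f²` is `f m` up to a constant, and take `u = (2 f, m², √3)` and `v = (f m, √3 k, 2 m)`; it
remains to subtract `𝒟(m²) ≤ 4 𝒟(m)`.
-/

open scoped ENNReal NNReal Topology
open MeasureTheory Filter Metric Set Real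

/-! ### Fatou's theorem on radial limits -/

/-- The majorant `d / max(d, |s|)²` of the Poisson kernel at height `d` above the boundary, as a
function of the distance `s` along the boundary. -/
noncomputable def poissonMajorant (d s : ℝ) : ℝ :=
  d / max d |s| ^ 2

@[fun_prop]
lemma measurable_poissonMajorant (d : ℝ) : Measurable (poissonMajorant d) := by
  unfold poissonMajorant
  fun_prop

lemma poissonMajorant_le {d s τ : ℝ} (hd : 0 ≤ d) (hτ : 0 < τ) (hs : τ ≤ |s|) :
    poissonMajorant d s ≤ d / τ ^ 2 := by
  have : τ ≤ max d |s| := hs.trans (le_max_right _ _)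
  unfold poissonMajorant
  gcongr

lemma exists_poissonMajorant_le {d : ℝ} (hd : 0 < d) (s : ℝ) :
    ∃ k : ℕ, |s| ≤ 2 ^ k * d ∧ poissonMajorant d s ≤ 4 * (1 / 4) ^ k / d := by
  have hex : ∃ k : ℕ, |s| ≤ 2 ^ k * d := by
    obtain ⟨k, hk⟩ := pow_unbounded_of_one_lt (|s| / d) one_lt_two
    exact ⟨k, ((div_lt_iff₀ hd).1 hk).le⟩
  classical
  refine ⟨Nat.find hex, Nat.find_spec hex, ?_⟩
  rw [poissonMajorant, div_le_div_iff₀ (by positivity) hd]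
  rcases hk : Nat.find hex with - | k
  · nlinarith [le_max_left d |s|]
  have hlt : 2 ^ k * d < |s| := by
    simpa using Nat.find_min hex (m := k) (by omega)
  have hinv : ((1 : ℝ) / 4) ^ k * (2 ^ 2) ^ k = 1 := by rw [← mul_pow]; norm_num
  calc d * d = 4 * (1 / 4) ^ (k + 1) * (2 ^ k * d) ^ 2 := by
        rw [mul_pow, ← pow_mul, mul_comm k 2, pow_mul, pow_succ]
        linear_combination (-d ^ 2) * hinv
    _ ≤ 4 * (1 / 4) ^ (k + 1) * max d |s| ^ 2 := by
        gcongr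
        exact hlt.le.trans (le_max_right _ _)

/-- The dyadic decomposition of the majorant turns a bound on centred averages into a bound on the
integral, uniformly in the height `d`. -/
lemma lintegral_poissonMajorant_mul_le {G : ℝ → ℝ≥0∞} (hG : AEMeasurable G) {x : ℝ} {ε : ℝ≥0∞}
    (h : ∀ τ : ℝ, 0 < τ → ∫⁻ t in closedBall x τ, G t ≤ ε * ENNReal.ofReal τ) {d : ℝ}
    (hd : 0 < d) :
    ∫⁻ t, ENNReal.ofReal (poissonMajorant d (t - x)) * G t ≤ 8 * ε := by
  have hscale (k : ℕ) : ENNReal.ofReal (4 * (1 / 4) ^ k / d) * ENNReal.ofReal (2 ^ k * d) =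
      4 * (2⁻¹ : ℝ≥0∞) ^ k := by
    have : 4 * (1 / 4) ^ k / d * (2 ^ k * d) = 4 * (2⁻¹ : ℝ) ^ k := by
      rw [show (2⁻¹ : ℝ) = 1 / 4 * 2 by norm_num, mul_pow]
      field_simp
    rw [← ENNReal.ofReal_mul (by positivity), this, ENNReal.ofReal_mul (by norm_num),
      ENNReal.ofReal_pow (by norm_num), ENNReal.ofReal_inv_of_pos (by norm_num)]
    simp only [ENNReal.ofReal_ofNat]
  calc ∫⁻ t, ENNReal.ofReal (poissonMajorant d (t - x)) * G t
      ≤ ∫⁻ t, ∑' k : ℕ, ENNReal.ofReal (4 * (1 / 4) ^ k / d) *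
        (closedBall x (2 ^ k * d)).indicator G t := by
        refine lintegral_mono fun t => ?_
        obtain ⟨k, hk, hle⟩ := exists_poissonMajorant_le hd (t - x)
        refine le_trans ?_ (ENNReal.le_tsum k)
        rw [indicator_of_mem (by simpa [Real.dist_eq] using hk)]
        gcongr
    _ = ∑' k : ℕ, ENNReal.ofReal (4 * (1 / 4) ^ k / d) *
        ∫⁻ t in closedBall x (2 ^ k * d), G t := by
      rw [lintegral_tsum fun k => (hG.indicator isClosed_closedBall.measurableSet).const_mul _]
      congr with k
      rw [lintegral_const_mul' _ _ ENNReal.ofReal_ne_top,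
        lintegral_indicator isClosed_closedBall.measurableSet]
    _ ≤ ∑' k : ℕ, ENNReal.ofReal (4 * (1 / 4) ^ k / d) *
        (ε * ENNReal.ofReal (2 ^ k * d)) := by
      gcongr with k
      exact h _ (by positivity)
    _ = ∑' k : ℕ, 4 * ε * (2⁻¹ : ℝ≥0∞) ^ k := by
      congr with k
      rw [mul_left_comm, hscale]
      ring
    _ = 8 * ε := by
      rw [ENNReal.tsum_mul_left, ENNReal.tsum_geometric, ENNReal.one_sub_inv_two, inv_inv]
      ring

lemma setLIntegral_poissonMajorant_mul_le {G : ℝ → ℝ≥0∞} (hG : AEMeasurable G) {x τ₀ : ℝ}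
    (hτ₀ : 0 < τ₀) {ε : ℝ≥0∞}
    (h : ∀ τ ∈ Ioc 0 τ₀, ∫⁻ t in closedBall x τ, G t ≤ ε * ENNReal.ofReal τ) {d : ℝ}
    (hd : 0 < d) (s : Set ℝ) :
    ∫⁻ t in s, ENNReal.ofReal (poissonMajorant d (t - x)) * G t ≤
      8 * ε + ENNReal.ofReal (d / τ₀ ^ 2) * ∫⁻ t in s, G t := by
  have hmeas (τ : ℝ) : MeasurableSet (closedBall x τ) := isClosed_closedBall.measurableSet
  have hG' : AEMeasurable ((closedBall x τ₀).indicator G) := hG.indicator (hmeas τ₀)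
  have hnear (τ : ℝ) (hτ : 0 < τ) :
      ∫⁻ t in closedBall x τ, (closedBall x τ₀).indicator G t ≤ ε * ENNReal.ofReal τ := by
    rw [lintegral_indicator (hmeas τ₀), Measure.restrict_restrict (hmeas τ₀)]
    rcases le_total τ τ₀ with hle | hle
    · exact (lintegral_mono_set inter_subset_right).trans (h τ ⟨hτ, hle⟩)
    · refine (lintegral_mono_set inter_subset_left).trans ((h τ₀ ⟨hτ₀, le_rfl⟩).trans ?_)
      gcongr
  calc ∫⁻ t in s, ENNReal.ofReal (poissonMajorant d (t - x)) * G t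
      ≤ ∫⁻ t in s, (ENNReal.ofReal (poissonMajorant d (t - x)) *
          (closedBall x τ₀).indicator G t + ENNReal.ofReal (d / τ₀ ^ 2) * G t) := by
        refine lintegral_mono fun t => ?_
        by_cases ht : t ∈ closedBall x τ₀
        · rw [indicator_of_mem ht]
          exact le_self_add
        · rw [indicator_of_notMem ht, mul_zero, zero_add]
          rw [mem_closedBall, Real.dist_eq, not_le] at ht
          gcongr
          exact poissonMajorant_le hd.le hτ₀ ht.le
    _ = (∫⁻ t in s, ENNReal.ofReal (poissonMajorant d (t - x)) *
          (closedBall x τ₀).indicator G t) + ENNReal.ofReal (d / τ₀ ^ 2) * ∫⁻ t in s, G t := by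
        rw [lintegral_add_left', lintegral_const_mul' _ _ ENNReal.ofReal_ne_top]
        exact (Measurable.aemeasurable (by fun_prop)).mul hG'.restrict
    _ ≤ _ := by
        gcongr
        exact (setLIntegral_le_lintegral _ _).trans
          (lintegral_poissonMajorant_mul_le hG' hnear hd)

lemma tendsto_setLIntegral_poissonMajorant_mul {G : ℝ → ℝ≥0∞} (hG : AEMeasurable G) {x : ℝ}
    {s : Set ℝ} (hs : ∫⁻ t in s, G t ≠ ∞)
    (h : ∀ ε : ℝ≥0∞, 0 < ε → ∃ τ₀ > 0, ∀ τ ∈ Ioc 0 τ₀,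
      ∫⁻ t in closedBall x τ, G t ≤ ε * ENNReal.ofReal τ) :
    Tendsto (fun d : ℝ => ∫⁻ t in s, ENNReal.ofReal (poissonMajorant d (t - x)) * G t)
      (𝓝[>] 0) (𝓝 0) := by
  rw [ENNReal.tendsto_nhds_zero]
  intro e he
  obtain ⟨τ₀, hτ₀, hτ⟩ := h (e / 2 / 8) (by simp [he.ne'])
  have hfar : Tendsto (fun d : ℝ => ENNReal.ofReal (d / τ₀ ^ 2) * ∫⁻ t in s, G t)
      (𝓝[>] 0) (𝓝 0) := by
    have : Continuous fun d : ℝ => ENNReal.ofReal (d / τ₀ ^ 2) :=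
      ENNReal.continuous_ofReal.comp (by fun_prop)
    simpa using ENNReal.Tendsto.mul_const
      ((this.tendsto 0).mono_left nhdsWithin_le_nhds) (Or.inr hs)
  filter_upwards [ENNReal.tendsto_nhds_zero.1 hfar (e / 2) (by simp [he.ne']),
    self_mem_nhdsWithin] with d hd hd0
  calc ∫⁻ t in s, ENNReal.ofReal (poissonMajorant d (t - x)) * G t
      ≤ 8 * (e / 2 / 8) + ENNReal.ofReal (d / τ₀ ^ 2) * ∫⁻ t in s, G t :=
        setLIntegral_poissonMajorant_mul_le hG hτ₀ hτ hd0 s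
    _ ≤ e / 2 + e / 2 := by
        rw [ENNReal.mul_div_cancel (by norm_num) (by norm_num)]
        gcongr
    _ = e := ENNReal.add_halves e

lemma two_div_pi_mul_abs_le_norm_circleMap_sub {t x : ℝ} (h : |t - x| ≤ π) :
    2 / π * |t - x| ≤ ‖circleMap 0 1 t - circleMap 0 1 x‖ := by
  have hrot : circleMap 0 1 t - circleMap 0 1 x =
      circleMap 0 1 x * (Complex.exp (Complex.I * ((t - x : ℝ) : ℂ)) - 1) := by
    simp only [circleMap_zero, Complex.ofReal_one, one_mul, mul_sub, mul_one, ← Complex.exp_add]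
    congr 2
    push_cast
    ring
  have hsin := Real.mul_abs_le_abs_sin (x := (t - x) / 2) (by rw [abs_div, abs_two]; linarith)
  rw [hrot, norm_mul, norm_circleMap_zero, Complex.norm_exp_I_mul_ofReal_sub_one, abs_one,
    one_mul, norm_mul, Real.norm_eq_abs, Real.norm_eq_abs, abs_two]
  rw [abs_div, abs_two] at hsin
  linarith

lemma one_sub_le_norm_circleMap_sub_mul {r : ℝ} (hr : 0 ≤ r) (t x : ℝ) :
    1 - r ≤ ‖circleMap 0 1 t - r * circleMap 0 1 x‖ := by
  simpa [abs_of_nonneg hr] using norm_sub_norm_le (circleMap 0 1 t) (r * circleMap 0 1 x)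

lemma abs_sub_le_pi_mul_norm_circleMap_sub_mul {t x r : ℝ} (h : |t - x| ≤ π)
    (hr : r ∈ Icc (0 : ℝ) 1) : |t - x| ≤ π * ‖circleMap 0 1 t - r * circleMap 0 1 x‖ := by
  have hx : ‖(r : ℂ) * circleMap 0 1 x - circleMap 0 1 x‖ = 1 - r := by
    rw [← sub_one_mul, norm_mul, norm_circleMap_zero, abs_one, mul_one,
      ← Complex.ofReal_one, ← Complex.ofReal_sub, Complex.norm_real, Real.norm_eq_abs,
      abs_sub_comm, abs_of_nonneg (sub_nonneg.2 hr.2)]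
  have hchord := (two_div_pi_mul_abs_le_norm_circleMap_sub h).trans
    (norm_sub_le_norm_sub_add_norm_sub _ ((r : ℂ) * circleMap 0 1 x) _)
  rw [hx, div_mul_eq_mul_div, div_le_iff₀ pi_pos] at hchord
  nlinarith [one_sub_le_norm_circleMap_sub_mul hr.1 t x, pi_pos]

lemma poissonKernel_radial_le {t x r : ℝ} (h : |t - x| ≤ π) (hr : r ∈ Ioo (0 : ℝ) 1) :
    poissonKernel 0 (r * circleMap 0 1 x) (circleMap 0 1 t) ≤
      2 * π ^ 2 * poissonMajorant (1 - r) (t - x) := by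
  obtain ⟨h0, h1⟩ := hr
  have hn : ‖(r : ℂ) * circleMap 0 1 x‖ = r := by simp [abs_of_pos h0]
  have hd : 0 < 1 - r := sub_pos.2 h1
  rw [poissonKernel_def, poissonMajorant]
  simp only [sub_zero, hn, norm_circleMap_zero, abs_one]
  have hD := one_sub_le_norm_circleMap_sub_mul h0.le t x
  have hfar := abs_sub_le_pi_mul_norm_circleMap_sub_mul h ⟨h0.le, h1.le⟩
  set D := ‖circleMap 0 1 t - r * circleMap 0 1 x‖
  have hD0 : 0 < D := hd.trans_le hD
  have hm : max (1 - r) |t - x| ≤ π * D :=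
    max_le (by nlinarith [pi_gt_three]) hfar
  rw [← mul_div_assoc, div_le_div_iff₀ (by positivity) (pow_pos (lt_max_of_lt_left hd) 2)]
  calc (1 ^ 2 - r ^ 2) * max (1 - r) |t - x| ^ 2 ≤ (1 ^ 2 - r ^ 2) * (π * D) ^ 2 := by
        have : 0 ≤ 1 ^ 2 - r ^ 2 := by nlinarith
        gcongr
    _ = (1 + r) * (1 - r) * π ^ 2 * D ^ 2 := by ring
    _ ≤ 2 * (1 - r) * π ^ 2 * D ^ 2 := by gcongr; linarith
    _ = _ := by ring

lemma continuousOn_poissonKernel_sphere {w : ℂ} (hw : w ∈ ball (0 : ℂ) 1) :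
    ContinuousOn (poissonKernel 0 w) (sphere 0 |1|) := by
  rw [poissonKernel_eq_re_herglotzRieszKernel]
  exact Complex.continuous_re.comp_continuousOn (continuousOn_herglotzRieszKernel_sphere hw)

lemma poissonKernel_nonneg {w : ℂ} (hw : w ∈ ball (0 : ℂ) 1) {z : ℂ} (hz : ‖z‖ = 1) :
    0 ≤ poissonKernel 0 w z := by
  have hw1 : ‖w‖ < 1 := by simpa using hw
  rw [poissonKernel_def]
  simp only [sub_zero, hz]
  have : 0 ≤ 1 ^ 2 - ‖w‖ ^ 2 := by nlinarith [norm_nonneg w]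
  positivity

lemma mul_circleMap_mem_ball {r : ℝ} (hr : r ∈ Ioo (0 : ℝ) 1) (x : ℝ) :
    (r : ℂ) * circleMap 0 1 x ∈ ball (0 : ℂ) 1 := by
  simpa [abs_of_pos hr.1] using hr.2

lemma ae_exists_lintegral_enorm_sub_le {E : Type*} [NormedAddCommGroup E] {g : ℝ → E}
    (hg : LocallyIntegrable g) :
    ∀ᵐ x : ℝ, ∀ ε : ℝ≥0∞, 0 < ε → ∃ τ₀ > 0, ∀ τ ∈ Ioc 0 τ₀,
      ∫⁻ t in closedBall x τ, ‖g t - g x‖ₑ ≤ ε * ENNReal.ofReal τ := by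
  filter_upwards [IsUnifLocDoublingMeasure.ae_tendsto_average_norm_sub.{0, _, 0} volume hg 1]
    with x hx ε hε
  have hlim : Tendsto (fun τ : ℝ => ENNReal.ofReal (⨍ t in closedBall x τ, ‖g t - g x‖))
      (𝓝[>] 0) (𝓝 0) := by
    rw [← ENNReal.ofReal_zero]
    refine ENNReal.tendsto_ofReal (hx (fun _ => x) id tendsto_id ?_)
    filter_upwards [self_mem_nhdsWithin] with τ hτ
    simpa using (mem_Ioi.1 hτ).le
  obtain ⟨τ₀, hτ₀, hle⟩ := mem_nhdsGT_iff_exists_Ioc_subset.1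
    (ENNReal.tendsto_nhds_zero.1 hlim (ε / 2) (ENNReal.half_pos hε.ne'))
  refine ⟨τ₀, hτ₀, fun τ hτ => ?_⟩
  have hint : IntegrableOn (fun t => g t - g x) (closedBall x τ) :=
    (hg.integrableOn_isCompact (isCompact_closedBall x τ)).sub
      (integrableOn_const measure_closedBall_lt_top.ne)
  have hvol : ENNReal.ofReal (2 * τ) ≠ 0 := by simpa using hτ.1
  have hav := hle hτ
  rw [mem_ofPred_eq, ofReal_setAverage hint.norm (Eventually.of_forall fun _ => norm_nonneg _),
    Real.volume_closedBall, ENNReal.div_le_iff hvol ENNReal.ofReal_ne_top] at hav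
  calc ∫⁻ t in closedBall x τ, ‖g t - g x‖ₑ
      = ∫⁻ t in closedBall x τ, ENNReal.ofReal ‖g t - g x‖ := by simp only [ofReal_norm]
    _ ≤ ε / 2 * ENNReal.ofReal (2 * τ) := hav
    _ = ε * ENNReal.ofReal τ := by
        rw [ENNReal.ofReal_mul zero_le_two, ENNReal.ofReal_ofNat, ← mul_assoc,
          ENNReal.div_mul_cancel (by norm_num) (by norm_num)]

lemma locallyIntegrable_comp_circleMap {E : Type*} [NormedAddCommGroup E] {φ : ℂ → E}
    (hφ : CircleIntegrable φ 0 1) : LocallyIntegrable fun x => φ (circleMap 0 1 x) := by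
  have hper : Function.Periodic (fun x => φ (circleMap 0 1 x)) (2 * π) := fun x =>
    congrArg φ (periodic_circleMap 0 1 x)
  intro x
  refine ⟨closedBall x 1, closedBall_mem_nhds x one_pos, ?_⟩
  rw [Real.closedBall_eq_Icc, ← intervalIntegrable_iff_integrableOn_Icc_of_le (by linarith)]
  exact hper.intervalIntegrable₀ (by positivity) hφ _ _

/-- The Poisson integral of a function on the unit circle. -/
noncomputable def poissonIntegral {E : Type*} [NormedAddCommGroup E] [NormedSpace ℝ E]
    (φ : ℂ → E) (z : ℂ) : E :=
  circleAverage (fun ζ => poissonKernel 0 z ζ • φ ζ) 0 1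

section PoissonIntegral

variable {E : Type*} [NormedAddCommGroup E] [NormedSpace ℝ E] {φ ψ : ℂ → E} {w : ℂ}

lemma circleIntegrable_poissonKernel_smul (hφ : CircleIntegrable φ 0 1)
    (hw : w ∈ ball (0 : ℂ) 1) : CircleIntegrable (fun ζ => poissonKernel 0 w ζ • φ ζ) 0 1 :=
  hφ.continuousOn_smul (continuousOn_poissonKernel_sphere hw)

lemma poissonIntegral_sub (hφ : CircleIntegrable φ 0 1) (hψ : CircleIntegrable ψ 0 1)
    (hw : w ∈ ball (0 : ℂ) 1) :
    poissonIntegral (fun ζ => φ ζ - ψ ζ) w = poissonIntegral φ w - poissonIntegral ψ w := by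
  simp only [poissonIntegral, smul_sub]
  exact circleAverage_fun_sub (circleIntegrable_poissonKernel_smul hφ hw)
    (circleIntegrable_poissonKernel_smul hψ hw)

lemma poissonIntegral_const [CompleteSpace E] (a : E) (hw : w ∈ ball (0 : ℂ) 1) :
    poissonIntegral (fun _ => a) w = a := by
  let T : ℂ →L[ℝ] E := Complex.reCLM.smulRight a
  have hcauchy := (diffContOnCl_const (𝕜 := ℂ) (s := ball (0 : ℂ) 1)
    (c := (1 : ℂ))).circleAverage_poissonKernel_smul hw
  have hint : CircleIntegrable (poissonKernel 0 w • fun _ => (1 : ℂ)) 0 1 :=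
    circleIntegrable_poissonKernel_smul (circleIntegrable_const _ _ _) hw
  have hcomp := T.circleAverage_comp_comm hint
  rw [hcauchy] at hcomp
  simpa [Function.comp_def, poissonIntegral, T] using hcomp

lemma enorm_circleAverage_le (φ : ℂ → E) (x : ℝ) :
    ‖circleAverage φ 0 1‖ₑ ≤
      ENNReal.ofReal (2 * π)⁻¹ * ∫⁻ t in closedBall x π, ‖φ (circleMap 0 1 t)‖ₑ := by
  rw [circleAverage_eq_integral_add (x - π),
    intervalIntegral.integral_comp_add_right (fun θ => φ (circleMap 0 1 θ)), enorm_smul,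
    Real.enorm_of_nonneg (by positivity), intervalIntegral.integral_of_le (by linarith [pi_pos])]
  refine mul_le_mul_right ((enorm_integral_le_lintegral_enorm _).trans (lintegral_mono_set ?_)) _
  rw [Real.closedBall_eq_Icc]
  exact Ioc_subset_Icc_self.trans (Icc_subset_Icc (by linarith) (by linarith))

lemma enorm_poissonIntegral_sub_le [CompleteSpace E] (hφ : CircleIntegrable φ 0 1) {r : ℝ}
    (hr : r ∈ Ioo (0 : ℝ) 1) (x : ℝ) :
    ‖poissonIntegral φ (r * circleMap 0 1 x) - φ (circleMap 0 1 x)‖ₑ ≤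
      ENNReal.ofReal π * ∫⁻ t in closedBall x π,
        ENNReal.ofReal (poissonMajorant (1 - r) (t - x)) *
          ‖φ (circleMap 0 1 t) - φ (circleMap 0 1 x)‖ₑ := by
  have hw := mul_circleMap_mem_ball hr x
  set a := φ (circleMap 0 1 x)
  set w : ℂ := r * circleMap 0 1 x
  calc ‖poissonIntegral φ w - a‖ₑ
      = ‖poissonIntegral (fun ζ => φ ζ - a) w‖ₑ := by
        rw [poissonIntegral_sub hφ (circleIntegrable_const _ _ _) hw, poissonIntegral_const a hw]
    _ ≤ ENNReal.ofReal (2 * π)⁻¹ * ∫⁻ t in closedBall x π,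
        ‖poissonKernel 0 w (circleMap 0 1 t) • (φ (circleMap 0 1 t) - a)‖ₑ :=
        enorm_circleAverage_le _ x
    _ ≤ ENNReal.ofReal (2 * π)⁻¹ * ∫⁻ t in closedBall x π, ENNReal.ofReal (2 * π ^ 2) *
        (ENNReal.ofReal (poissonMajorant (1 - r) (t - x)) * ‖φ (circleMap 0 1 t) - a‖ₑ) := by
        refine mul_le_mul_right
          (setLIntegral_mono' isClosed_closedBall.measurableSet fun t ht => ?_) _
        rw [mem_closedBall, Real.dist_eq] at ht
        rw [enorm_smul, ← mul_assoc, ← ENNReal.ofReal_mul (by positivity),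
          Real.enorm_of_nonneg (poissonKernel_nonneg hw (by simp))]
        gcongr
        exact poissonKernel_radial_le ht hr
    _ = _ := by
        rw [lintegral_const_mul' _ _ ENNReal.ofReal_ne_top, ← mul_assoc,
          ← ENNReal.ofReal_mul (by positivity)]
        congr 2
        field_simp

/-- **Fatou's theorem**: the Poisson integral of an integrable function on the circle has that
function as its radial limit almost everywhere. -/
theorem ae_tendsto_poissonIntegral [CompleteSpace E] (hφ : CircleIntegrable φ 0 1) :
    ∀ᵐ x : ℝ, Tendsto (fun r : ℝ => poissonIntegral φ (r * circleMap 0 1 x)) (𝓝[<] 1)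
      (𝓝 (φ (circleMap 0 1 x))) := by
  have hloc := locallyIntegrable_comp_circleMap hφ
  filter_upwards [ae_exists_lintegral_enorm_sub_le hloc] with x hx
  have hdist : Tendsto (fun r : ℝ => 1 - r) (𝓝[<] 1) (𝓝[>] 0) := by
    refine tendsto_nhdsWithin_iff.2 ⟨?_, ?_⟩
    · have : Continuous fun r : ℝ => 1 - r := by fun_prop
      simpa using (this.tendsto 1).mono_left nhdsWithin_le_nhds
    · filter_upwards [self_mem_nhdsWithin] with r hr using sub_pos.2 (mem_Iio.1 hr)
  have hfin : ∫⁻ t in closedBall x π, ‖φ (circleMap 0 1 t) - φ (circleMap 0 1 x)‖ₑ ≠ ∞ :=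
    ((hloc.integrableOn_isCompact (isCompact_closedBall x π)).sub
      (integrableOn_const measure_closedBall_lt_top.ne)).2.ne
  have hmeas : AEMeasurable fun t => ‖φ (circleMap 0 1 t) - φ (circleMap 0 1 x)‖ₑ :=
    (hloc.aestronglyMeasurable.sub aestronglyMeasurable_const).enorm
  have hmaj := ENNReal.Tendsto.const_mul (a := ENNReal.ofReal π)
    ((tendsto_setLIntegral_poissonMajorant_mul hmeas hfin hx).comp hdist)
    (Or.inr ENNReal.ofReal_ne_top)
  rw [mul_zero] at hmaj
  rw [tendsto_iff_edist_tendsto_0]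
  refine tendsto_of_tendsto_of_tendsto_of_le_of_le' tendsto_const_nhds hmaj
    (Eventually.of_forall fun _ => zero_le) ?_
  filter_upwards [Ioo_mem_nhdsLT zero_lt_one] with r hr
  rw [edist_eq_enorm_sub]
  exact enorm_poissonIntegral_sub_le hφ hr x

end PoissonIntegral

/-! ### Boundary functions in the Hardy space `H²` -/

lemma exists_weak_limit_of_bounded {H : Type*} [NormedAddCommGroup H] [InnerProductSpace ℂ H]
    [CompleteSpace H] {ι : Type*} (U : Ultrafilter ι) {x : ι → H} {C : ℝ} (hx : ∀ i, ‖x i‖ ≤ C) :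
    ∃ y : H, ∀ v : H, Tendsto (fun i => inner ℂ v (x i)) U (𝓝 (inner ℂ v y)) := by
  let T : ι → WeakDual ℂ H := fun i => StrongDual.toWeakDual (InnerProductSpace.toDual ℂ H (x i))
  obtain ⟨Λ, -, hΛ⟩ := (WeakDual.isCompact_closedBall (𝕜 := ℂ) (E := H) 0 C).ultrafilter_le_nhds
    (U.map T) (by
      rw [Ultrafilter.coe_map, le_principal_iff, mem_map]
      exact Filter.univ_mem' fun i => by simpa [T] using hx i)
  refine ⟨(InnerProductSpace.toDual ℂ H).symm (WeakDual.toStrongDual Λ), fun v => ?_⟩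
  have hT : Tendsto T U (𝓝 Λ) := hΛ
  have heval : Tendsto (fun i => inner ℂ (x i) v) U (𝓝 (Λ v)) := by
    simpa [T, Function.comp_def] using ((WeakDual.eval_continuous v).tendsto Λ).comp hT
  have hconj := (Complex.continuous_conj.tendsto _).comp heval
  simp only [Function.comp_def, inner_conj_symm] at hconj
  convert hconj using 2
  rw [← inner_conj_symm, InnerProductSpace.toDual_symm_apply]
  rfl

/-- Arc length on the unit circle, as a measure on `ℂ`. -/
noncomputable def arcLength : Measure ℂ :=
  Measure.map (circleMap 0 1) (volume.restrict (Ioc 0 (2 * π)))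

instance : IsFiniteMeasure arcLength := by
  unfold arcLength
  infer_instance

section ArcLength

variable {E : Type*} [NormedAddCommGroup E] {φ ψ : ℂ → E}

lemma ae_arcLength_mem_sphere : ∀ᵐ ζ ∂arcLength, ζ ∈ sphere (0 : ℂ) 1 :=
  (ae_map_iff (p := fun ζ => ζ ∈ sphere (0 : ℂ) 1) (by fun_prop)
    isClosed_sphere.measurableSet).2 (Eventually.of_forall fun θ => by simp)

lemma memLp_arcLength (hφ : ContinuousOn φ (sphere 0 1)) (p : ℝ≥0∞) : MemLp φ p arcLength := by
  obtain ⟨C, hC⟩ := (isCompact_sphere (0 : ℂ) 1).exists_bound_of_continuousOn hφ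
  have hmeas := hφ.aestronglyMeasurable_of_isCompact (μ := arcLength) (isCompact_sphere _ _)
    isClosed_sphere.measurableSet
  rw [Measure.restrict_eq_self_of_ae_mem ae_arcLength_mem_sphere] at hmeas
  refine MemLp.of_bound hmeas C ?_
  filter_upwards [ae_arcLength_mem_sphere] with ζ hζ using hC ζ hζ

lemma circleAverage_eq_integral_arcLength [NormedSpace ℝ E]
    (hφ : AEStronglyMeasurable φ arcLength) :
    circleAverage φ 0 1 = (2 * π)⁻¹ • ∫ ζ, φ ζ ∂arcLength := by
  rw [circleAverage_def, arcLength, integral_map (by fun_prop) hφ,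
    intervalIntegral.integral_of_le (by positivity)]

lemma circleIntegrable_of_integrable_arcLength (hφ : Integrable φ arcLength) :
    CircleIntegrable φ 0 1 := by
  rw [CircleIntegrable, intervalIntegrable_iff_integrableOn_Ioc_of_le (by positivity)]
  exact (integrable_map_measure hφ.1 (by fun_prop)).1 hφ

lemma norm_toLp_arcLength_sq {F : ℂ → ℂ} (hF : ContinuousOn F (sphere 0 1)) :
    ‖(memLp_arcLength hF 2).toLp‖ ^ 2 = 2 * π * circleAverage (fun ζ => ‖F ζ‖ ^ 2) 0 1 := by
  rw [circleAverage_eq_integral_arcLength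
      (memLp_arcLength (φ := fun ζ => ‖F ζ‖ ^ 2) (hF.norm.pow 2) 1).1,
    smul_eq_mul, mul_inv_cancel_left₀ (by positivity), ← inner_self_eq_norm_sq (𝕜 := ℂ),
    L2.inner_def, ← integral_re (L2.integrable_inner _ _)]
  refine integral_congr_ae ?_
  filter_upwards [(memLp_arcLength hF 2).coeFn_toLp] with ζ hζ
  rw [hζ, inner_self_eq_norm_sq (𝕜 := ℂ)]

end ArcLength

lemma exists_poissonIntegral_eq_inner {z : ℂ} (hz : z ∈ ball (0 : ℂ) 1) :
    ∃ p : Lp ℂ 2 arcLength, ∀ (F : ℂ → ℂ) (hF : MemLp F 2 arcLength),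
      poissonIntegral F z = inner ℂ p hF.toLp := by
  have hP : ContinuousOn (fun ζ => (poissonKernel 0 z ζ : ℂ)) (sphere 0 1) := by
    have := continuousOn_poissonKernel_sphere hz
    rw [abs_one] at this
    exact Complex.continuous_ofReal.comp_continuousOn this
  have hPm := memLp_arcLength hP 2
  refine ⟨((2 * π)⁻¹ : ℝ) • hPm.toLp, fun F hF => ?_⟩
  have hmeas : AEStronglyMeasurable (fun ζ => poissonKernel 0 z ζ • F ζ) arcLength := by
    simp only [Complex.real_smul]
    exact hPm.1.mul hF.1
  rw [poissonIntegral, circleAverage_eq_integral_arcLength hmeas, inner_smul_left_eq_smul,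
    L2.inner_def]
  congr 1
  refine integral_congr_ae ?_
  filter_upwards [hPm.coeFn_toLp, hF.coeFn_toLp] with ζ hPζ hFζ
  rw [hPζ, hFζ]
  simp [mul_comm]

lemma diffContOnCl_dilate {f : ℂ → ℂ} (hf : DifferentiableOn ℂ f (ball 0 1)) {r : ℝ}
    (hr : r ∈ Ioo (0 : ℝ) 1) : DiffContOnCl ℂ (fun ζ => f (r * ζ)) (ball 0 1) := by
  have hmaps : MapsTo (fun ζ : ℂ => (r : ℂ) * ζ) (closedBall 0 1) (ball 0 1) := fun ζ hζ => by
    have hζ1 : ‖ζ‖ ≤ 1 := by simpa using hζ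
    rw [mem_ball_zero_iff, norm_mul, Complex.norm_real, Real.norm_eq_abs, abs_of_pos hr.1]
    nlinarith [hr.1, hr.2]
  refine ⟨hf.comp (by fun_prop) (hmaps.mono_left ball_subset_closedBall), ?_⟩
  rw [closure_ball _ one_ne_zero]
  exact hf.continuousOn.comp (by fun_prop) hmaps

namespace MemHardy

lemma exists_norm_toLp_dilate_le {f : ℂ → ℂ} (hf : MemHardy 2 f) :
    ∃ C : ℝ, ∀ r ∈ Ioo (0 : ℝ) 1, ∃ hF : MemLp (fun ζ => f (r * ζ)) 2 arcLength,
      ‖hF.toLp‖ ≤ C := by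
  obtain ⟨hd, C, hC⟩ := hf
  refine ⟨√(2 * π * C), fun r hr => ?_⟩
  have hF : ContinuousOn (fun ζ => f (r * ζ)) (sphere 0 1) :=
    (diffContOnCl_dilate hd hr).continuousOn_ball.mono sphere_subset_closedBall
  refine ⟨memLp_arcLength hF 2, Real.le_sqrt_of_sq_le ?_⟩
  rw [norm_toLp_arcLength_sq hF]
  gcongr
  have hmean := hC r hr
  rw [circleAverage_eq_circleAverage_zero_one] at hmean
  simpa using hmean

lemma exists_eq_poissonIntegral {f : ℂ → ℂ} (hf : MemHardy 2 f) :
    ∃ φ : ℂ → ℂ, CircleIntegrable φ 0 1 ∧ ∀ z ∈ ball (0 : ℂ) 1, f z = poissonIntegral φ z := by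
  obtain ⟨C, hC⟩ := hf.exists_norm_toLp_dilate_le
  obtain ⟨R, -, hR, hRlim⟩ := exists_seq_strictMono_tendsto' (zero_lt_one' ℝ)
  choose hF hFC using fun n => hC (R n) (hR n)
  obtain ⟨φ, hφ⟩ := exists_weak_limit_of_bounded (hyperfilter ℕ) hFC
  refine ⟨φ, circleIntegrable_of_integrable_arcLength
    ((Lp.memLp φ).integrable (by norm_num)), fun z hz => ?_⟩
  obtain ⟨p, hp⟩ := exists_poissonIntegral_eq_inner hz
  have hdil (n : ℕ) : inner ℂ p (hF n).toLp = f (R n * z) :=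
    (hp _ (hF n)).symm.trans ((diffContOnCl_dilate hf.1 (hR n)).circleAverage_poissonKernel_smul hz)
  have hweak := hφ p
  simp only [hdil] at hweak
  rw [hp φ (Lp.memLp φ), Lp.toLp_coeFn]
  refine tendsto_nhds_unique (Tendsto.mono_left ?_ Nat.hyperfilter_le_atTop) hweak
  have hRz : Tendsto (fun n => (R n : ℂ) * z) atTop (𝓝 z) := by
    simpa using ((Complex.continuous_ofReal.tendsto 1).comp hRlim).mul_const z
  exact (hf.1.differentiableAt (isOpen_ball.mem_nhds hz)).continuousAt.tendsto.comp hRz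

theorem ae_tendsto_radialLimit {f : ℂ → ℂ} (hf : MemHardy 2 f) :
    ∀ᵐ x : ℝ, Tendsto (fun r : ℝ => f (r * circleMap 0 1 x)) (𝓝[<] 1)
      (𝓝 (radialLimit f (circleMap 0 1 x))) := by
  obtain ⟨φ, hφ, hfφ⟩ := hf.exists_eq_poissonIntegral
  filter_upwards [ae_tendsto_poissonIntegral hφ] with x hx
  refine tendsto_nhds_limUnder ⟨_, hx.congr' ?_⟩
  filter_upwards [Ioo_mem_nhdsLT zero_lt_one] with r hr
  exact (hfφ _ (mul_circleMap_mem_ball hr x)).symm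

end MemHardy

/-! ### Moduli and square means of outer functions -/

section PoissonIntegralReal

variable {h k : ℂ → ℝ} {z : ℂ}

lemma poissonIntegral_const_mul (b : ℝ) : poissonIntegral (fun ζ => b * h ζ) z =
    b * poissonIntegral h z := by
  simp only [poissonIntegral, ← smul_eq_mul b, smul_comm _ b, circleAverage_fun_smul]

lemma poissonIntegral_mono (hh : CircleIntegrable h 0 1) (hk : CircleIntegrable k 0 1)
    (hhk : ∀ ζ, h ζ ≤ k ζ) (hz : z ∈ ball (0 : ℂ) 1) :
    poissonIntegral h z ≤ poissonIntegral k z :=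
  circleAverage_mono (circleIntegrable_poissonKernel_smul hh hz)
    (circleIntegrable_poissonKernel_smul hk hz) fun ζ hζ =>
      mul_le_mul_of_nonneg_left (hhk ζ) (poissonKernel_nonneg hz (by simpa using hζ))

/-- Jensen's inequality: integrate the tangent line of `exp` at the value of the left side. -/
lemma exp_poissonIntegral_le (hh : CircleIntegrable h 0 1)
    (he : CircleIntegrable (fun ζ => exp (h ζ)) 0 1) (hz : z ∈ ball (0 : ℂ) 1) :
    exp (poissonIntegral h z) ≤ poissonIntegral (fun ζ => exp (h ζ)) z := by
  set m := poissonIntegral h z with hm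
  have hconst : CircleIntegrable (fun _ : ℂ => m - 1) 0 1 := circleIntegrable_const _ _ _
  have htangent (ζ : ℂ) : exp m * (h ζ - (m - 1)) ≤ exp (h ζ) := by
    calc exp m * (h ζ - (m - 1)) = exp m * (h ζ - m + 1) := by ring
      _ ≤ exp m * exp (h ζ - m) := by gcongr; exact add_one_le_exp _
      _ = exp (h ζ) := by rw [← exp_add, add_sub_cancel]
  calc exp m = poissonIntegral (fun ζ => exp m * (h ζ - (m - 1))) z := by
        rw [poissonIntegral_const_mul, poissonIntegral_sub hh hconst hz,
          poissonIntegral_const _ hz, ← hm, sub_sub_cancel, mul_one]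
    _ ≤ _ := poissonIntegral_mono ((hh.sub hconst).const_smul (a := exp m)) he htangent hz

lemma circleIntegrable_ofReal (hh : CircleIntegrable h 0 1) :
    CircleIntegrable (fun ζ => (h ζ : ℂ)) 0 1 := by
  simp only [CircleIntegrable, intervalIntegrable_iff] at hh ⊢
  exact Complex.ofRealCLM.integrable_comp hh

lemma circleIntegrable_herglotz_mul (hh : CircleIntegrable h 0 1) (hz : z ∈ ball (0 : ℂ) 1) :
    CircleIntegrable (fun ζ => (ζ + z) / (ζ - z) * (h ζ : ℂ)) 0 1 := by
  have := (circleIntegrable_ofReal hh).continuousOn_smul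
    (continuousOn_herglotzRieszKernel_sphere hz)
  simpa [herglotzRieszKernel_fun_def, Pi.mul_def] using this

lemma differentiableOn_herglotz (hh : CircleIntegrable h 0 1) :
    DifferentiableOn ℂ (fun z => circleAverage (fun ζ => (ζ + z) / (ζ - z) * (h ζ : ℂ)) 0 1)
      (ball 0 1) := by
  simpa only [herglotzRieszKernel_def, sub_zero, smul_eq_mul] using
    differentiableOn_circleAverage_herglotzRieszKernel_smul (circleIntegrable_ofReal hh)

lemma poissonIntegral_eq_re_herglotz (hh : CircleIntegrable h 0 1) (hz : z ∈ ball (0 : ℂ) 1) :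
    poissonIntegral h z = (circleAverage (fun ζ => (ζ + z) / (ζ - z) * (h ζ : ℂ)) 0 1).re := by
  have := re_circleAverage_herglotzRieszKernel_smul hh hz
  simp only [herglotzRieszKernel_def, sub_zero, smul_eq_mul] at this
  rw [this, poissonIntegral, poissonKernel_eq_re_herglotzRieszKernel]
  rfl

lemma continuousOn_poissonIntegral (hh : CircleIntegrable h 0 1) :
    ContinuousOn (poissonIntegral h) (ball 0 1) :=
  (Complex.continuous_re.comp_continuousOn (differentiableOn_herglotz hh).continuousOn).congr
    fun _ hz => poissonIntegral_eq_re_herglotz hh hz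

lemma circleAverage_poissonIntegral (hh : CircleIntegrable h 0 1) {r : ℝ}
    (hr : r ∈ Ioo (0 : ℝ) 1) :
    circleAverage (poissonIntegral h) 0 r = circleAverage h 0 1 := by
  set H : ℂ → ℂ := fun z => circleAverage (fun ζ => (ζ + z) / (ζ - z) * (h ζ : ℂ)) 0 1
  have hH := differentiableOn_herglotz hh
  have hsub : closedBall (0 : ℂ) r ⊆ ball 0 1 := closedBall_subset_ball hr.2
  have hsphere : sphere (0 : ℂ) |r| ⊆ ball 0 1 := by
    rw [abs_of_pos hr.1]
    exact sphere_subset_closedBall.trans hsub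
  have hint : CircleIntegrable H 0 r :=
    (hH.continuousOn.mono (by rwa [abs_of_pos hr.1] at hsphere)).circleIntegrable hr.1.le
  have hmean : circleAverage H 0 r = H 0 := by
    refine DiffContOnCl.circleAverage ?_
    rw [abs_of_pos hr.1]
    exact (hH.mono hsub).diffContOnCl_ball subset_rfl
  have hzero : (0 : ℂ) ∈ ball (0 : ℂ) 1 := mem_ball_self one_pos
  calc circleAverage (poissonIntegral h) 0 r
      = circleAverage (Complex.reCLM ∘ H) 0 r :=
        circleAverage_congr_sphere fun z hz => poissonIntegral_eq_re_herglotz hh (hsphere hz)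
    _ = (H 0).re := by rw [Complex.reCLM.circleAverage_comp_comm hint, hmean, Complex.reCLM_apply]
    _ = poissonIntegral h 0 := (poissonIntegral_eq_re_herglotz hh hzero).symm
    _ = circleAverage h 0 1 := by
        refine circleAverage_congr_sphere fun ζ hζ => ?_
        have hζ1 : ‖ζ‖ = 1 := by simpa using hζ
        simp [poissonKernel_def, hζ1]

end PoissonIntegralReal

section OuterExp

variable {h k : ℂ → ℝ} {z : ℂ}

lemma differentiableOn_outerExp (hh : CircleIntegrable h 0 1) :
    DifferentiableOn ℂ (outerExp h) (ball 0 1) :=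
  (differentiableOn_herglotz hh).cexp

lemma norm_outerExp (hh : CircleIntegrable h 0 1) (hz : z ∈ ball (0 : ℂ) 1) :
    ‖outerExp h z‖ = exp (poissonIntegral h z) := by
  rw [outerExp, Complex.norm_exp, poissonIntegral_eq_re_herglotz hh hz]

@[simp]
lemma outerExp_zero : outerExp 0 = 1 := by
  ext z
  simp [outerExp, circleAverage_def]

lemma outerExp_add (hh : CircleIntegrable h 0 1) (hk : CircleIntegrable k 0 1)
    (hz : z ∈ ball (0 : ℂ) 1) : outerExp (h + k) z = outerExp h z * outerExp k z := by
  rw [outerExp, outerExp, outerExp, ← Complex.exp_add, ← circleAverage_fun_add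
    (circleIntegrable_herglotz_mul hh hz) (circleIntegrable_herglotz_mul hk hz)]
  simp only [Pi.add_apply, Complex.ofReal_add, mul_add]

lemma outerExp_congr_ae (hhk : ∀ᵐ x : ℝ, h (circleMap 0 1 x) = k (circleMap 0 1 x)) :
    outerExp h = outerExp k := by
  ext z
  rw [outerExp, outerExp, circleAverage_def, circleAverage_def]
  congr 2
  refine intervalIntegral.integral_congr_ae ?_
  filter_upwards [hhk] with x hx _
  rw [hx]

lemma norm_outerExp_mono (hh : CircleIntegrable h 0 1) (hk : CircleIntegrable k 0 1)
    (hhk : ∀ ζ, h ζ ≤ k ζ) (hz : z ∈ ball (0 : ℂ) 1) : ‖outerExp h z‖ ≤ ‖outerExp k z‖ := by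
  rw [norm_outerExp hh hz, norm_outerExp hk hz]
  exact exp_le_exp.2 (poissonIntegral_mono hh hk hhk hz)

lemma norm_outerExp_sq_le (hh : CircleIntegrable h 0 1)
    (he : CircleIntegrable (fun ζ => exp (2 * h ζ)) 0 1) (hz : z ∈ ball (0 : ℂ) 1) :
    ‖outerExp h z‖ ^ 2 ≤ poissonIntegral (fun ζ => exp (2 * h ζ)) z := by
  rw [norm_outerExp hh hz, ← exp_nat_mul, Nat.cast_two, ← poissonIntegral_const_mul]
  exact exp_poissonIntegral_le (hh.const_smul (a := (2 : ℝ))) he hz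

lemma ae_tendsto_norm_outerExp (hh : CircleIntegrable h 0 1) :
    ∀ᵐ x : ℝ, Tendsto (fun r : ℝ => ‖outerExp h (r * circleMap 0 1 x)‖) (𝓝[<] 1)
      (𝓝 (exp (h (circleMap 0 1 x)))) := by
  filter_upwards [ae_tendsto_poissonIntegral hh] with x hx
  refine ((continuous_exp.tendsto _).comp hx).congr' ?_
  filter_upwards [Ioo_mem_nhdsLT zero_lt_one] with r hr
  exact (norm_outerExp hh (mul_circleMap_mem_ball hr x)).symm

end OuterExp

/-- The integral of an extended nonnegative function over the circle of centre `a` and radius `δ`,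
with respect to the angle. -/
noncomputable def circleLIntegral (v : ℂ → ℝ≥0∞) (a : ℂ) (δ : ℝ) : ℝ≥0∞ :=
  ∫⁻ θ in Ioc 0 (2 * π), v (circleMap a δ θ)

lemma circleMap_zero_eq_mul (r x : ℝ) : circleMap 0 r x = r * circleMap 0 1 x := by
  simp [circleMap]

lemma circleLIntegral_const (b : ℝ≥0∞) (a : ℂ) (δ : ℝ) :
    circleLIntegral (fun _ => b) a δ = b * ENNReal.ofReal (2 * π) := by
  rw [circleLIntegral, setLIntegral_const, Real.volume_Ioc, sub_zero]

lemma circleLIntegral_mono {v w : ℂ → ℝ≥0∞} {a : ℂ} {δ : ℝ}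
    (h : ∀ θ, v (circleMap a δ θ) ≤ w (circleMap a δ θ)) :
    circleLIntegral v a δ ≤ circleLIntegral w a δ :=
  lintegral_mono h

lemma circleLIntegral_congr {v w : ℂ → ℝ≥0∞} {a : ℂ} {δ : ℝ}
    (h : ∀ θ, v (circleMap a δ θ) = w (circleMap a δ θ)) :
    circleLIntegral v a δ = circleLIntegral w a δ :=
  lintegral_congr h

lemma circleLIntegral_ofReal {φ : ℂ → ℝ} {a : ℂ} {r : ℝ} (hφ : CircleIntegrable φ a r)
    (h0 : ∀ θ, 0 ≤ φ (circleMap a r θ)) :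
    circleLIntegral (fun z => ENNReal.ofReal (φ z)) a r =
      ENNReal.ofReal (2 * π * circleAverage φ a r) := by
  rw [CircleIntegrable, intervalIntegrable_iff_integrableOn_Ioc_of_le (by positivity)] at hφ
  rw [circleAverage_def, smul_eq_mul, mul_inv_cancel_left₀ (by positivity),
    intervalIntegral.integral_of_le (by positivity),
    ofReal_integral_eq_lintegral_ofReal hφ (Eventually.of_forall h0)]
  rfl

lemma enorm_sq_eq_ofReal {E : Type*} [SeminormedAddCommGroup E] (x : E) :
    ‖x‖ₑ ^ 2 = ENNReal.ofReal (‖x‖ ^ 2) := by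
  rw [← ofReal_norm, ENNReal.ofReal_pow (norm_nonneg x)]

lemma circleMap_zero_mem_ball {r : ℝ} (hr : r ∈ Ioo (0 : ℝ) 1) (x : ℝ) :
    circleMap 0 r x ∈ ball (0 : ℂ) 1 := by
  rw [circleMap_zero_eq_mul]
  exact mul_circleMap_mem_ball hr x

section SquareMeans

variable {h : ℂ → ℝ}

lemma circleLIntegral_enorm_sq_outerExp_le (hh : CircleIntegrable h 0 1)
    (he : CircleIntegrable (fun ζ => exp (2 * h ζ)) 0 1) {r : ℝ} (hr : r ∈ Ioo (0 : ℝ) 1) :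
    circleLIntegral (fun z => ‖outerExp h z‖ₑ ^ 2) 0 r ≤
      circleLIntegral (fun ζ => ENNReal.ofReal (exp (2 * h ζ))) 0 1 := by
  have hle (θ : ℝ) := norm_outerExp_sq_le hh he (circleMap_zero_mem_ball hr θ)
  have hint : CircleIntegrable (poissonIntegral fun ζ => exp (2 * h ζ)) 0 r :=
    ((continuousOn_poissonIntegral he).mono (sphere_subset_ball hr.2)).circleIntegrable hr.1.le
  calc circleLIntegral (fun z => ‖outerExp h z‖ₑ ^ 2) 0 r
      ≤ circleLIntegral (fun z => ENNReal.ofReal (poissonIntegral (fun ζ => exp (2 * h ζ)) z))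
          0 r := circleLIntegral_mono fun θ => by
        rw [enorm_sq_eq_ofReal]
        exact ENNReal.ofReal_le_ofReal (hle θ)
    _ = circleLIntegral (fun ζ => ENNReal.ofReal (exp (2 * h ζ))) 0 1 := by
        rw [circleLIntegral_ofReal hint fun θ => (sq_nonneg _).trans (hle θ),
          circleLIntegral_ofReal he fun _ => (exp_pos _).le, circleAverage_poissonIntegral he hr]

lemma circleLIntegral_exp_le_of_frequently (hh : CircleIntegrable h 0 1) {M : ℝ≥0∞}
    (hM : ∃ᶠ r in 𝓝[<] 1, circleLIntegral (fun z => ‖outerExp h z‖ₑ ^ 2) 0 r ≤ M) :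
    circleLIntegral (fun ζ => ENNReal.ofReal (exp (2 * h ζ))) 0 1 ≤ M := by
  obtain ⟨u, hu, huM⟩ := exists_seq_forall_of_frequently
    (hM.and_eventually (Ioo_mem_nhdsLT zero_lt_one))
  have hlim : ∀ᵐ x : ℝ, ENNReal.ofReal (exp (2 * h (circleMap 0 1 x))) ≤
      liminf (fun n => ‖outerExp h (circleMap 0 (u n) x)‖ₑ ^ 2) atTop := by
    filter_upwards [ae_tendsto_norm_outerExp hh] with x hx
    have hsq := ENNReal.tendsto_ofReal ((hx.comp hu).pow 2)
    rw [← exp_nat_mul, Nat.cast_two] at hsq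
    simpa only [enorm_sq_eq_ofReal, circleMap_zero_eq_mul (u _), Function.comp_apply]
      using hsq.liminf_eq.ge
  have hmeas (n : ℕ) : Measurable fun x => ‖outerExp h (circleMap 0 (u n) x)‖ₑ ^ 2 :=
    ((differentiableOn_outerExp hh).continuousOn.comp_continuous (continuous_circleMap 0 (u n))
      (circleMap_zero_mem_ball (huM n).2)).enorm.measurable.pow_const 2
  calc circleLIntegral (fun ζ => ENNReal.ofReal (exp (2 * h ζ))) 0 1
      ≤ ∫⁻ x in Ioc 0 (2 * π), liminf (fun n => ‖outerExp h (circleMap 0 (u n) x)‖ₑ ^ 2) atTop :=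
        lintegral_mono_ae (ae_restrict_of_ae hlim)
    _ ≤ liminf (fun n => circleLIntegral (fun z => ‖outerExp h z‖ₑ ^ 2) 0 (u n)) atTop :=
        lintegral_liminf_le hmeas
    _ ≤ M := liminf_le_of_le (by isBoundedDefault) fun b hb => by
        obtain ⟨n, hn⟩ := hb.exists
        exact hn.trans (huM n).1

lemma tendsto_circleLIntegral_enorm_sq_outerExp (hh : CircleIntegrable h 0 1)
    (he : CircleIntegrable (fun ζ => exp (2 * h ζ)) 0 1) :
    Tendsto (fun r => circleLIntegral (fun z => ‖outerExp h z‖ₑ ^ 2) 0 r) (𝓝[<] 1)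
      (𝓝 (circleLIntegral (fun ζ => ENNReal.ofReal (exp (2 * h ζ))) 0 1)) := by
  refine tendsto_order.2 ⟨fun b hb => ?_, fun b hb => ?_⟩
  · by_contra hlow
    refine hb.not_ge (circleLIntegral_exp_le_of_frequently hh ?_)
    simpa only [not_eventually, not_lt] using hlow
  · filter_upwards [Ioo_mem_nhdsLT zero_lt_one] with r hr
    exact (circleLIntegral_enorm_sq_outerExp_le hh he hr).trans_lt hb

end SquareMeans

namespace MemHardy

variable {f : ℂ → ℂ} {h : ℂ → ℝ}

lemma circleIntegrable_exp (hf : MemHardy 2 f) (hh : CircleIntegrable h 0 1)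
    (hfh : ∀ z ∈ ball (0 : ℂ) 1, ‖f z‖ = ‖outerExp h z‖) :
    CircleIntegrable (fun ζ => exp (2 * h ζ)) 0 1 := by
  obtain ⟨hd, C, hC⟩ := hf
  have hbound : ∀ᶠ r in 𝓝[<] 1,
      circleLIntegral (fun z => ‖outerExp h z‖ₑ ^ 2) 0 r ≤ ENNReal.ofReal (2 * π * C) := by
    filter_upwards [Ioo_mem_nhdsLT zero_lt_one] with r hr
    have hint : CircleIntegrable (fun z => ‖f z‖ ^ (2 : ℝ)) 0 r :=
      ((hd.continuousOn.mono (sphere_subset_ball hr.2)).norm.rpow_const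
        (by norm_num)).circleIntegrable hr.1.le
    calc circleLIntegral (fun z => ‖outerExp h z‖ₑ ^ 2) 0 r
        = circleLIntegral (fun z => ENNReal.ofReal (‖f z‖ ^ (2 : ℝ))) 0 r :=
          circleLIntegral_congr fun θ => by
            rw [enorm_sq_eq_ofReal, hfh _ (circleMap_zero_mem_ball hr θ), Real.rpow_two]
      _ = ENNReal.ofReal (2 * π * circleAverage (fun z => ‖f z‖ ^ (2 : ℝ)) 0 r) :=
          circleLIntegral_ofReal hint fun θ => by positivity
      _ ≤ ENNReal.ofReal (2 * π * C) := by
          gcongr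
          exact hC r hr
  have hfin := circleLIntegral_exp_le_of_frequently hh hbound.frequently
  rw [CircleIntegrable, intervalIntegrable_iff_integrableOn_Ioc_of_le (by positivity)] at hh ⊢
  refine ⟨continuous_exp.comp_aestronglyMeasurable (hh.1.const_mul 2), ?_⟩
  rw [hasFiniteIntegral_iff_ofReal (Eventually.of_forall fun _ => (exp_pos _).le)]
  exact hfin.trans_lt ENNReal.ofReal_lt_top

lemma ae_norm_radialLimit_eq (hf : MemHardy 2 f) (hh : CircleIntegrable h 0 1)
    (hfh : ∀ z ∈ ball (0 : ℂ) 1, ‖f z‖ = ‖outerExp h z‖) :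
    ∀ᵐ x : ℝ, ‖radialLimit f (circleMap 0 1 x)‖ = exp (h (circleMap 0 1 x)) := by
  filter_upwards [hf.ae_tendsto_radialLimit, ae_tendsto_norm_outerExp hh] with x hfx hhx
  refine tendsto_nhds_unique (hfx.norm.congr' ?_) hhx
  filter_upwards [Ioo_mem_nhdsLT zero_lt_one] with r hr
  exact hfh _ (mul_circleMap_mem_ball hr x)

lemma ae_radialLimit_sq_eq (hf : MemHardy 2 f) :
    ∀ᵐ x : ℝ, radialLimit (fun z => f z ^ 2) (circleMap 0 1 x) =
      radialLimit f (circleMap 0 1 x) ^ 2 := by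
  filter_upwards [hf.ae_tendsto_radialLimit] with x hx using (hx.pow 2).limUnder_eq

end MemHardy

/-! ### Circle integrals of superharmonic functions -/

section CircleLIntegral

variable {v w : ℂ → ℝ≥0∞} {a : ℂ} {δ : ℝ}

lemma circleLIntegral_add (hv : Measurable v) :
    circleLIntegral (fun b => v b + w b) a δ = circleLIntegral v a δ + circleLIntegral w a δ :=
  lintegral_add_left (hv.comp (by fun_prop)) _

lemma circleLIntegral_eq_setLIntegral (v : ℂ → ℝ≥0∞) (a : ℂ) (δ t : ℝ) :
    circleLIntegral v a δ = ∫⁻ θ in Ioc t (t + 2 * π), v (circleMap a δ θ) := by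
  have hdom := isAddFundamentalDomain_Ioc (T := 2 * π) (by positivity)
  have hshift := (hdom 0).setLIntegral_eq (hdom t) (fun θ => v (circleMap a δ θ)) fun g x => by
    obtain ⟨_, k, rfl⟩ := g
    simp only [AddSubgroup.vadd_def, vadd_eq_add, zsmul_eq_mul]
    rw [add_comm, (periodic_circleMap a δ).int_mul k x]
  rwa [zero_add] at hshift

lemma circleLIntegral_neg (v : ℂ → ℝ≥0∞) (a : ℂ) (δ : ℝ) :
    circleLIntegral v a (-δ) = circleLIntegral v a δ := by
  have htrans := (measurePreserving_add_right (volume : Measure ℝ) π).setLIntegral_comp_preimage_emb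
    (measurableEmbedding_addRight π) (fun θ => v (circleMap a δ θ)) (Ioc π (π + 2 * π))
  rw [preimage_add_const_Ioc, sub_self, add_sub_cancel_left] at htrans
  rw [circleLIntegral_eq_setLIntegral v a δ π, circleLIntegral, ← htrans]
  simp only [circleMap_neg_radius]

lemma lintegral_mul_circleLIntegral_comm (hv : Measurable v) (hw : Measurable w) (δ : ℝ) :
    ∫⁻ a, w a * circleLIntegral v a δ = ∫⁻ b, v b * circleLIntegral w b δ := by
  have hmeas (s : ℝ) : Measurable fun p : ℂ × ℝ => circleMap p.1 s p.2 := by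
    unfold circleMap
    fun_prop
  have hpull (f g : ℂ → ℝ≥0∞) (hg : Measurable g) (s : ℝ) :
      ∫⁻ a, f a * circleLIntegral g a s =
        ∫⁻ a, ∫⁻ θ in Ioc 0 (2 * π), f a * g (circleMap a s θ) :=
    lintegral_congr fun a => (lintegral_const_mul _ (hg.comp (by fun_prop))).symm
  calc ∫⁻ a, w a * circleLIntegral v a δ
      = ∫⁻ θ in Ioc 0 (2 * π), ∫⁻ a, w a * v (circleMap a δ θ) := by
        rw [hpull w v hv, lintegral_lintegral_swap]
        exact ((hw.comp measurable_fst).mul (hv.comp (hmeas δ))).aemeasurable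
    _ = ∫⁻ θ in Ioc 0 (2 * π), ∫⁻ b, v b * w (circleMap b (-δ) θ) :=
        lintegral_congr fun θ => by
          rw [← lintegral_add_right_eq_self (fun b => v b * w (circleMap b (-δ) θ))
            (circleMap 0 δ θ)]
          refine lintegral_congr fun a => ?_
          have hadd : a + circleMap 0 δ θ = circleMap a δ θ := by
            rw [← circleMap_sub_center, add_sub_cancel]
          have hsub : circleMap (a + circleMap 0 δ θ) (-δ) θ = a := by
            unfold circleMap
            push_cast
            ring
          rw [hsub, hadd, mul_comm]
    _ = ∫⁻ b, v b * circleLIntegral w b (-δ) := by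
        rw [hpull v w hw]
        exact (lintegral_lintegral_swap
          ((hv.comp measurable_fst).mul (hw.comp (hmeas (-δ)))).aemeasurable).symm
    _ = ∫⁻ b, v b * circleLIntegral w b δ := by simp only [circleLIntegral_neg]

lemma lintegral_eq_lintegral_circleLIntegral (hv : Measurable v) :
    ∫⁻ z, v z = ∫⁻ ρ in Ioi 0, ENNReal.ofReal ρ * circleLIntegral v 0 ρ := by
  have hsymm (ρ θ : ℝ) : Complex.polarCoord.symm (ρ, θ) = circleMap 0 ρ θ := by
    rw [Complex.polarCoord_symm_apply, circleMap_zero, Complex.exp_mul_I]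
    push_cast
    ring
  have hmeas : Measurable fun p : ℝ × ℝ => v (Complex.polarCoord.symm p) := by
    simp only [Complex.polarCoord_symm_apply]
    fun_prop
  rw [← Complex.lintegral_comp_polarCoord_symm, polarCoord_target, Measure.volume_eq_prod,
    ← Measure.prod_restrict, lintegral_prod]
  swap
  · exact (measurable_fst.ennreal_ofReal.smul hmeas).aemeasurable
  refine lintegral_congr fun ρ => ?_
  simp only [smul_eq_mul, hsymm]
  rw [lintegral_const_mul' _ _ ENNReal.ofReal_ne_top, circleLIntegral_eq_setLIntegral v 0 ρ (-π),
    setLIntegral_congr Ioo_ae_eq_Ioc, two_mul, neg_add_cancel_left]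

lemma setLIntegral_annulus_le (hv : Measurable v) {s t : ℝ} (ht : t ≤ 1) {η : ℝ≥0∞}
    (hη : ∀ ρ ∈ Ioo s t, circleLIntegral v 0 ρ ≤ η) :
    ∫⁻ z in norm ⁻¹' Ioo s t, v z ≤ ENNReal.ofReal (t - s) * η := by
  have hA : MeasurableSet (norm ⁻¹' Ioo s t : Set ℂ) := measurableSet_Ioo.preimage measurable_norm
  have hnorm {ρ : ℝ} (hρ : 0 < ρ) (θ : ℝ) : ‖circleMap 0 ρ θ‖ = ρ := by
    rw [norm_circleMap_zero, abs_of_pos hρ]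
  rw [← lintegral_indicator hA, lintegral_eq_lintegral_circleLIntegral (hv.indicator hA)]
  calc ∫⁻ ρ in Ioi 0, ENNReal.ofReal ρ * circleLIntegral ((norm ⁻¹' Ioo s t).indicator v) 0 ρ
      ≤ ∫⁻ ρ in Ioi (0 : ℝ), (Ioo s t).indicator (fun _ => η) ρ := by
        refine setLIntegral_mono' measurableSet_Ioi fun ρ (hρ : 0 < ρ) => ?_
        by_cases hmem : ρ ∈ Ioo s t
        · rw [indicator_of_mem hmem, ← one_mul η]
          refine mul_le_mul' (ENNReal.ofReal_le_one.2 (hmem.2.le.trans ht))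
            (le_trans (circleLIntegral_mono fun θ => ?_) (hη ρ hmem))
          exact indicator_le_self _ _ _
        · rw [circleLIntegral_congr (w := fun _ => 0) fun θ => indicator_of_notMem (by
            rwa [mem_preimage, hnorm hρ]) _, circleLIntegral_const, zero_mul, mul_zero]
          exact zero_le
    _ ≤ ∫⁻ ρ, (Ioo s t).indicator (fun _ => η) ρ := setLIntegral_le_lintegral _ _
    _ = ENNReal.ofReal (t - s) * η := by
        rw [lintegral_indicator measurableSet_Ioo, setLIntegral_const, Real.volume_Ioo, mul_comm]

end CircleLIntegral

namespace IsPosSuperharmonicOn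

variable {ω : ℂ → ℝ≥0∞} {U : Set ℂ}

lemma measurable_indicator (hω : IsPosSuperharmonicOn ω U) (hU : IsOpen U) :
    Measurable (U.indicator ω) := by
  refine LowerSemicontinuous.measurable (lowerSemicontinuous_iff_isOpen_preimage.2 fun y => ?_)
  obtain ⟨t, ht, hpre⟩ := lowerSemicontinuousOn_iff_preimage_Ioi.1 hω.lowerSemicontinuousOn y
  have hind : U.indicator ω ⁻¹' Ioi y = U ∩ ω ⁻¹' Ioi y := by
    ext z
    by_cases hz : z ∈ U <;> simp [hz]
  rw [hind, hpre]
  exact hU.inter ht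

lemma circleLIntegral_le (hω : IsPosSuperharmonicOn ω U) {a : ℂ} {δ : ℝ} (hδ : 0 < δ)
    (hU : closedBall a δ ⊆ U) : circleLIntegral ω a δ ≤ ω a * ENNReal.ofReal (2 * π) :=
  (ENNReal.div_le_iff (by simp [pi_pos]) ENNReal.ofReal_ne_top).1 (hω.circle_mean_le a δ hδ hU)

end IsPosSuperharmonicOn

lemma circleAverage_norm_sq_eq_add {E : Type*} [NormedAddCommGroup E] [InnerProductSpace ℂ E]
    [CompleteSpace E] {u : ℂ → E} {a : ℂ} {δ : ℝ} (hδ : 0 < δ)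
    (hu : DifferentiableOn ℂ u (closedBall a δ)) :
    circleAverage (fun z => ‖u z‖ ^ 2) a δ =
      ‖u a‖ ^ 2 + circleAverage (fun z => ‖u z - u a‖ ^ 2) a δ := by
  let := InnerProductSpace.complexToReal (G := E)
  have hsphere : ContinuousOn u (sphere a δ) := hu.continuousOn.mono sphere_subset_closedBall
  have hsub : CircleIntegrable (fun z => u z - u a) a δ :=
    (hsphere.sub continuousOn_const).circleIntegrable hδ.le
  have hsubsq : CircleIntegrable (fun z => ‖u z - u a‖ ^ 2) a δ :=
    ((hsphere.sub continuousOn_const).norm.pow 2).circleIntegrable hδ.le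
  have hinner : CircleIntegrable (fun z => 2 * inner ℝ (u a) (u z - u a)) a δ :=
    (continuousOn_const.mul
      (continuousOn_const.inner (hsphere.sub continuousOn_const))).circleIntegrable hδ.le
  have hmean : circleAverage (fun z => u z - u a) a δ = 0 := by
    have hcl : DiffContOnCl ℂ (fun z => u z - u a) (ball a |δ|) := by
      rw [abs_of_pos hδ]
      exact (hu.sub_const _).diffContOnCl_ball subset_rfl
    rw [hcl.circleAverage, sub_self]
  have hcross : circleAverage (fun z => 2 * inner ℝ (u a) (u z - u a)) a δ = 0 := by
    have hcomp := (innerSL ℝ (u a)).circleAverage_comp_comm hsub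
    rw [hmean, map_zero] at hcomp
    simp only [← smul_eq_mul (2 : ℝ)]
    rw [circleAverage_fun_smul]
    exact smul_eq_zero_of_right _ hcomp
  calc circleAverage (fun z => ‖u z‖ ^ 2) a δ
      = circleAverage (fun z => (‖u a‖ ^ 2 + 2 * inner ℝ (u a) (u z - u a)) +
          ‖u z - u a‖ ^ 2) a δ := by
        simp only [← norm_add_sq_real, add_sub_cancel]
    _ = ‖u a‖ ^ 2 + circleAverage (fun z => ‖u z - u a‖ ^ 2) a δ := by
        have hconst := circleIntegrable_const (‖u a‖ ^ 2) a δ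
        rw [circleAverage_fun_add (f₁ := fun z => _ + 2 * inner ℝ (u a) (u z - u a))
          (hconst.add hinner) hsubsq, circleAverage_fun_add hconst hinner, circleAverage_const,
          hcross, add_zero]

/-- The function `z ↦ (n (r² - |z|²))⁺`, a paraboloid that is superharmonic on the disc of radius
`r` and grows to `∞` there with `n`; it truncates the weights. -/
noncomputable def paraboloid (n r : ℝ) (z : ℂ) : ℝ≥0∞ :=
  ENNReal.ofReal (n * (r ^ 2 - ‖z‖ ^ 2))

section Paraboloid

variable {n r δ : ℝ} {a : ℂ}

lemma norm_circleMap_mem_Icc (a : ℂ) (hδ : 0 ≤ δ) (θ : ℝ) :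
    ‖circleMap a δ θ‖ ∈ Icc (‖a‖ - δ) (‖a‖ + δ) := by
  have hdist : ‖circleMap a δ θ - a‖ = δ := by
    rw [circleMap_sub_center, norm_circleMap_zero, abs_of_nonneg hδ]
  constructor
  · linarith [norm_le_norm_add_norm_sub (circleMap a δ θ) a]
  · linarith [norm_le_norm_add_norm_sub' (circleMap a δ θ) a]

lemma paraboloid_eq_zero (hn : 0 ≤ n) (hr : 0 ≤ r) (ha : r ≤ ‖a‖) : paraboloid n r a = 0 := by
  have hsq : r ^ 2 ≤ ‖a‖ ^ 2 := by gcongr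
  exact ENNReal.ofReal_of_nonpos (mul_nonpos_of_nonneg_of_nonpos hn (by linarith))

lemma circleLIntegral_paraboloid_le (hn : 0 ≤ n) (hδ : 0 < δ) (har : ‖a‖ + δ ≤ r) :
    circleLIntegral (paraboloid n r) a δ ≤ paraboloid n r a * ENNReal.ofReal (2 * π) := by
  have hnonneg (θ : ℝ) : 0 ≤ n * (r ^ 2 - ‖circleMap a δ θ‖ ^ 2) := by
    have := (norm_circleMap_mem_Icc a hδ.le θ).2.trans har
    exact mul_nonneg hn (sub_nonneg.2 (by gcongr))
  have hint (k : ℂ → ℝ) (hk : Continuous k) : CircleIntegrable k a δ :=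
    hk.continuousOn.circleIntegrable hδ.le
  have hsub : ‖a‖ ^ 2 ≤ circleAverage (fun z : ℂ => ‖z‖ ^ 2) a δ := by
    rw [circleAverage_norm_sq_eq_add (u := fun z => z) hδ differentiableOn_id]
    refine le_add_of_nonneg_right (circleAverage_nonneg_of_nonneg fun z _ => by positivity)
  have hmean : circleAverage (fun z => n * (r ^ 2 - ‖z‖ ^ 2)) a δ ≤ n * (r ^ 2 - ‖a‖ ^ 2) := by
    simp only [← smul_eq_mul n]
    rw [circleAverage_fun_smul, circleAverage_fun_sub (hint _ (by fun_prop)) (hint _ (by fun_prop)),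
      circleAverage_const, smul_eq_mul, smul_eq_mul]
    gcongr
  unfold paraboloid
  rw [circleLIntegral_ofReal (hint _ (by fun_prop)) hnonneg, mul_comm,
    ← ENNReal.ofReal_mul' (by positivity)]
  gcongr

lemma circleLIntegral_paraboloid_le_add (hn : 0 ≤ n) (hδ : 0 ≤ δ) (ha : ‖a‖ + δ ≤ 1) :
    circleLIntegral (paraboloid n r) a δ ≤
      (paraboloid n r a + ENNReal.ofReal (n * (2 * δ))) * ENNReal.ofReal (2 * π) := by
  rw [← circleLIntegral_const _ a δ]
  refine circleLIntegral_mono fun θ => le_trans (ENNReal.ofReal_le_ofReal ?_) ENNReal.ofReal_add_le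
  obtain ⟨hlow, hup⟩ := norm_circleMap_mem_Icc a hδ θ
  rw [← mul_add]
  refine mul_le_mul_of_nonneg_left ?_ hn
  nlinarith [norm_nonneg a, norm_nonneg (circleMap a δ θ)]

end Paraboloid

/-- The truncation of a weight `ω` on the unit disc by the paraboloid `n (r² - |z|²)⁺`. It is
bounded, is supported in the disc of radius `r`, and is superharmonic away from its rim. -/
noncomputable def cutoffWeight (ω : ℂ → ℝ≥0∞) (n r : ℝ) (z : ℂ) : ℝ≥0∞ :=
  min (ω z) (paraboloid n r z)

section CutoffWeight

variable {ω : ℂ → ℝ≥0∞} {n r δ : ℝ} {a : ℂ}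

lemma cutoffWeight_le : cutoffWeight ω n r a ≤ ω a :=
  min_le_left _ _

lemma cutoffWeight_le_const (hn : 0 ≤ n) : cutoffWeight ω n r a ≤ ENNReal.ofReal (n * r ^ 2) := by
  refine (min_le_right _ _).trans (ENNReal.ofReal_le_ofReal ?_)
  gcongr
  exact sub_le_self _ (sq_nonneg _)

lemma cutoffWeight_eq_zero (hn : 0 ≤ n) (hr : 0 ≤ r) (ha : r ≤ ‖a‖) :
    cutoffWeight ω n r a = 0 := by
  rw [cutoffWeight, paraboloid_eq_zero hn hr ha, min_eq_right zero_le]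

lemma tendsto_cutoffWeight {x : ℕ → ℝ} (hx : Tendsto x atTop (𝓝 1)) (ha : a ∈ ball (0 : ℂ) 1) :
    Tendsto (fun k : ℕ => cutoffWeight ω k (x k) a) atTop (𝓝 (ω a)) := by
  have hpos : 0 < 1 ^ 2 - ‖a‖ ^ 2 := by
    rw [mem_ball_zero_iff] at ha
    nlinarith [norm_nonneg a]
  have htop : Tendsto (fun k : ℕ => paraboloid k (x k) a) atTop (𝓝 ∞) :=
    ENNReal.tendsto_ofReal_atTop.comp
      (tendsto_natCast_atTop_atTop.atTop_mul_pos hpos ((hx.pow 2).sub_const _))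
  simpa only [cutoffWeight, min_top_right] using tendsto_const_nhds.min htop

namespace IsPosSuperharmonicOn

variable (hω : IsPosSuperharmonicOn ω (ball 0 1))
include hω

lemma measurable_cutoffWeight (hn : 0 ≤ n) (hr : r ∈ Icc (0 : ℝ) 1) :
    Measurable (cutoffWeight ω n r) := by
  have hind : cutoffWeight ω n r = cutoffWeight ((ball 0 1).indicator ω) n r := by
    ext z
    by_cases hz : z ∈ ball (0 : ℂ) 1
    · rw [cutoffWeight, cutoffWeight, indicator_of_mem hz]
    · rw [mem_ball_zero_iff, not_lt] at hz
      rw [cutoffWeight_eq_zero hn hr.1 (hr.2.trans hz),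
        cutoffWeight_eq_zero hn hr.1 (hr.2.trans hz)]
  rw [hind]
  unfold cutoffWeight paraboloid
  exact (hω.measurable_indicator isOpen_ball).min (by fun_prop)

lemma circleLIntegral_cutoffWeight_le (hn : 0 ≤ n) (hr : 0 ≤ r) (hδ : 0 < δ)
    (hrδ : r + 2 * δ ≤ 1) (a : ℂ) :
    circleLIntegral (cutoffWeight ω n r) a δ ≤ (cutoffWeight ω n r a +
      (norm ⁻¹' Ioo (r - δ) (r + δ)).indicator (fun _ => ENNReal.ofReal (n * (2 * δ))) a) *
        ENNReal.ofReal (2 * π) := by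
  rcases le_or_gt (r + δ) ‖a‖ with hfar | hnear
  · rw [circleLIntegral_congr (w := fun _ => 0) fun θ => cutoffWeight_eq_zero hn hr
      (by linarith [(norm_circleMap_mem_Icc a hδ.le θ).1]), circleLIntegral_const, zero_mul]
    exact zero_le
  have hsub : closedBall a δ ⊆ ball (0 : ℂ) 1 :=
    closedBall_subset_ball' (by rw [dist_zero_right]; linarith)
  have hωa : circleLIntegral (cutoffWeight ω n r) a δ ≤ ω a * ENNReal.ofReal (2 * π) :=
    (circleLIntegral_mono fun θ => min_le_left _ _).trans (hω.circleLIntegral_le hδ hsub)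
  have hpar : circleLIntegral (cutoffWeight ω n r) a δ ≤ circleLIntegral (paraboloid n r) a δ :=
    circleLIntegral_mono fun θ => min_le_right _ _
  rcases le_or_gt ‖a‖ (r - δ) with hin | hrim
  · rw [indicator_of_notMem fun hmem => hmem.1.not_ge hin, add_zero, cutoffWeight, min_mul]
    exact le_min hωa (hpar.trans (circleLIntegral_paraboloid_le hn hδ (by linarith)))
  · rw [indicator_of_mem (show a ∈ norm ⁻¹' Ioo (r - δ) (r + δ) from ⟨hrim, hnear⟩),
      cutoffWeight, min_add, min_mul]
    refine le_min (hωa.trans ?_)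
      (hpar.trans (circleLIntegral_paraboloid_le_add hn hδ.le (by linarith)))
    gcongr
    exact le_self_add

end IsPosSuperharmonicOn

end CutoffWeight

/-! ### The comparison principle -/

/-- The integral of `‖slope u a ·‖²` over the circle of centre `a` and radius `δ`. For holomorphic
`u` it is the excess over `2π ‖u a‖²` of the integral of `‖u‖²` over this circle, divided by `δ²`,
so that it serves as a discrete Laplacian of `‖u‖²`. -/
noncomputable def circleSlope {E : Type*} [NormedAddCommGroup E] [NormedSpace ℂ E] (u : ℂ → E)
    (δ : ℝ) (a : ℂ) : ℝ≥0∞ :=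
  circleLIntegral (fun b => ‖slope u a b‖ₑ ^ 2) a δ

/-- The gap `‖v‖² - ‖u‖²`. The subtraction is truncated, so this is the intended quantity only where
`‖u‖ ≤ ‖v‖`. -/
noncomputable def normSqGap {E F : Type*} [NormedAddCommGroup E] [NormedAddCommGroup F]
    (u : ℂ → E) (v : ℂ → F) (z : ℂ) : ℝ≥0∞ :=
  ‖v z‖ₑ ^ 2 - ‖u z‖ₑ ^ 2

lemma enorm_sq_eq_add_normSqGap {E F : Type*} [NormedAddCommGroup E] [NormedAddCommGroup F]
    {u : ℂ → E} {v : ℂ → F} {z : ℂ} (h : ‖u z‖ ≤ ‖v z‖) :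
    ‖v z‖ₑ ^ 2 = ‖u z‖ₑ ^ 2 + normSqGap u v z := by
  refine (add_tsub_cancel_of_le ?_).symm
  rw [← ofReal_norm, ← ofReal_norm]
  gcongr

lemma tendsto_circleLIntegral {p : ℂ → ℝ≥0∞} {a : ℂ} {l : ℝ≥0∞} (hp : Tendsto p (𝓝[≠] a) (𝓝 l)) :
    Tendsto (fun δ => circleLIntegral p a δ) (𝓝[>] 0) (𝓝 (l * ENNReal.ofReal (2 * π))) := by
  have hcircle {q : ℂ → Prop} (hq : ∀ᶠ z in 𝓝[≠] a, q z) :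
      ∀ᶠ δ in 𝓝[>] 0, ∀ θ, q (circleMap a δ θ) := by
    obtain ⟨ε, hε, hball⟩ := Metric.eventually_nhds_iff.1 (eventually_nhdsWithin_iff.1 hq)
    filter_upwards [Ioo_mem_nhdsGT hε] with δ hδ θ
    refine hball ?_ (circleMap_ne_center hδ.1.ne')
    rw [dist_eq_norm, circleMap_sub_center, norm_circleMap_zero, abs_of_pos hδ.1]
    exact hδ.2
  have hpos : ENNReal.ofReal (2 * π) ≠ 0 := by simp [pi_pos]
  refine tendsto_order.2 ⟨fun b hb => ?_, fun b hb => ?_⟩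
  · obtain ⟨t, hbt, htl⟩ := exists_between
      ((ENNReal.div_lt_iff (Or.inl hpos) (Or.inl ENNReal.ofReal_ne_top)).2 hb)
    filter_upwards [hcircle (hp.eventually_const_lt htl)] with δ hδ
    calc b < t * ENNReal.ofReal (2 * π) :=
          (ENNReal.div_lt_iff (Or.inl hpos) (Or.inl ENNReal.ofReal_ne_top)).1 hbt
      _ = circleLIntegral (fun _ => t) a δ := (circleLIntegral_const t a δ).symm
      _ ≤ circleLIntegral p a δ := circleLIntegral_mono fun θ => (hδ θ).le
  · obtain ⟨t, hlt, htb⟩ := exists_between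
      ((ENNReal.lt_div_iff_mul_lt (Or.inl hpos) (Or.inl ENNReal.ofReal_ne_top)).2 hb)
    filter_upwards [hcircle (hp.eventually_lt_const hlt)] with δ hδ
    calc circleLIntegral p a δ ≤ circleLIntegral (fun _ => t) a δ :=
          circleLIntegral_mono fun θ => (hδ θ).le
      _ = t * ENNReal.ofReal (2 * π) := circleLIntegral_const t a δ
      _ < b := (ENNReal.lt_div_iff_mul_lt (Or.inl hpos) (Or.inl ENNReal.ofReal_ne_top)).1 htb

section CircleSlope

variable {E : Type*} [NormedAddCommGroup E] [InnerProductSpace ℂ E] {u : ℂ → E} {a : ℂ} {δ r : ℝ}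

lemma measurable_circleSlope [MeasurableSpace E] [BorelSpace E] [SecondCountableTopology E]
    (hu : Measurable u) (δ : ℝ) : Measurable (circleSlope u δ) := by
  unfold circleSlope circleLIntegral
  refine Measurable.lintegral_prod_right' (f := fun p : ℂ × ℝ =>
    ‖slope u p.1 (circleMap p.1 δ p.2)‖ₑ ^ 2) ?_
  simp only [slope, circleMap, vsub_eq_sub]
  fun_prop

lemma circleLIntegral_enorm_sq [CompleteSpace E] (hδ : 0 < δ)
    (hu : DifferentiableOn ℂ u (closedBall a δ)) :
    circleLIntegral (fun z => ‖u z‖ₑ ^ 2) a δ =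
      ‖u a‖ₑ ^ 2 * ENNReal.ofReal (2 * π) + ENNReal.ofReal δ ^ 2 * circleSlope u δ a := by
  have hsphere : ContinuousOn u (sphere a δ) := hu.continuousOn.mono sphere_subset_closedBall
  have hslope : ENNReal.ofReal δ ^ 2 * circleSlope u δ a =
      circleLIntegral (fun z => ENNReal.ofReal (‖u z - u a‖ ^ 2)) a δ := by
    rw [circleSlope, circleLIntegral, ← lintegral_const_mul' _ _ (by finiteness)]
    refine circleLIntegral_congr (v := fun z => ENNReal.ofReal δ ^ 2 * ‖slope u a z‖ₑ ^ 2)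
      fun θ => ?_
    have hδ_eq : ENNReal.ofReal δ = ‖circleMap a δ θ - a‖ₑ := by
      rw [← ofReal_norm, circleMap_sub_center, norm_circleMap_zero, abs_of_pos hδ]
    rw [← enorm_sq_eq_ofReal, ← mul_pow, hδ_eq, ← enorm_smul, sub_smul_slope, vsub_eq_sub]
  simp only [hslope, enorm_sq_eq_ofReal]
  rw [circleLIntegral_ofReal (ContinuousOn.circleIntegrable hδ.le (by fun_prop))
      fun θ => by positivity,
    circleLIntegral_ofReal (ContinuousOn.circleIntegrable hδ.le (by fun_prop))
      fun θ => by positivity,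
    circleAverage_norm_sq_eq_add hδ hu, mul_add, mul_comm (2 * π) (‖u a‖ ^ 2),
    ENNReal.ofReal_add (by positivity), ENNReal.ofReal_mul (by positivity)]
  exact mul_nonneg two_pi_pos.le (circleAverage_nonneg_of_nonneg fun z _ => by positivity)

lemma exists_circleSlope_le [CompleteSpace E] (hu : DifferentiableOn ℂ u (ball 0 1)) (hr : r < 1) :
    ∃ C ≠ ∞, ∀ᶠ δ in 𝓝[>] 0, ∀ a ∈ ball (0 : ℂ) r, circleSlope u δ a ≤ C := by
  obtain ⟨R, hrR, hR⟩ := exists_between hr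
  have hsmooth : ContDiffOn ℝ 1 u (closedBall 0 R) :=
    ((hu.contDiffOn isOpen_ball).restrict_scalars ℝ).mono (closedBall_subset_ball hR)
  obtain ⟨K, hK⟩ := hsmooth.exists_lipschitzOnWith one_ne_zero (convex_closedBall _ _)
    (isCompact_closedBall _ _)
  refine ⟨(K : ℝ≥0∞) ^ 2 * ENNReal.ofReal (2 * π), by finiteness, ?_⟩
  filter_upwards [Ioo_mem_nhdsGT (sub_pos.2 hrR)] with δ hδ a ha
  rw [mem_ball_zero_iff] at ha
  rw [← circleLIntegral_const _ a δ]
  refine circleLIntegral_mono fun θ => ?_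
  have hz : circleMap a δ θ ∈ closedBall (0 : ℂ) R := mem_closedBall_zero_iff.2
    (by linarith [(norm_circleMap_mem_Icc a hδ.1.le θ).2, hδ.2])
  have hne : ‖circleMap a δ θ - a‖ₑ ≠ 0 :=
    enorm_ne_zero.2 (sub_ne_zero.2 (circleMap_ne_center hδ.1.ne'))
  have hlip := hK hz (mem_closedBall_zero_iff.2 (ha.le.trans hrR.le))
  rw [edist_eq_enorm_sub, edist_eq_enorm_sub, ← vsub_eq_sub (u _), ← sub_smul_slope u, enorm_smul,
    mul_comm, ENNReal.mul_le_mul_iff_left hne (by finiteness)] at hlip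
  gcongr

end CircleSlope

lemma circleLIntegral_normSqGap {E F : Type*} [NormedAddCommGroup E] [InnerProductSpace ℂ E]
    [CompleteSpace E] [MeasurableSpace E] [OpensMeasurableSpace E] [NormedAddCommGroup F]
    [InnerProductSpace ℂ F] [CompleteSpace F] {u : ℂ → E} {v : ℂ → F} {a : ℂ} {δ : ℝ}
    (hum : Measurable u) (hδ : 0 < δ) (hu : DifferentiableOn ℂ u (closedBall a δ))
    (hv : DifferentiableOn ℂ v (closedBall a δ)) (huv : ∀ z ∈ closedBall a δ, ‖u z‖ ≤ ‖v z‖) :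
    ENNReal.ofReal δ ^ 2 * circleSlope u δ a + circleLIntegral (normSqGap u v) a δ =
      normSqGap u v a * ENNReal.ofReal (2 * π) + ENNReal.ofReal δ ^ 2 * circleSlope v δ a := by
  have hfin : ‖u a‖ₑ ^ 2 * ENNReal.ofReal (2 * π) ≠ ∞ := by finiteness
  refine (ENNReal.add_right_inj hfin).1 ?_
  calc ‖u a‖ₑ ^ 2 * ENNReal.ofReal (2 * π) +
        (ENNReal.ofReal δ ^ 2 * circleSlope u δ a + circleLIntegral (normSqGap u v) a δ)
      = circleLIntegral (fun z => ‖u z‖ₑ ^ 2 + normSqGap u v z) a δ := by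
        rw [circleLIntegral_add (hum.enorm.pow_const 2), circleLIntegral_enorm_sq hδ hu, add_assoc]
    _ = circleLIntegral (fun z => ‖v z‖ₑ ^ 2) a δ :=
        circleLIntegral_congr fun θ =>
          (enorm_sq_eq_add_normSqGap (huv _ (circleMap_mem_closedBall a hδ.le θ))).symm
    _ = ‖u a‖ₑ ^ 2 * ENNReal.ofReal (2 * π) +
          (normSqGap u v a * ENNReal.ofReal (2 * π) +
            ENNReal.ofReal δ ^ 2 * circleSlope v δ a) := by
        rw [circleLIntegral_enorm_sq hδ hv,
          enorm_sq_eq_add_normSqGap (huv a (mem_closedBall_self hδ.le)), add_mul, add_assoc]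

lemma measurable_indicator_of_isOpen {X E : Type*} [TopologicalSpace X] [MeasurableSpace X]
    [OpensMeasurableSpace X] [TopologicalSpace E] [MeasurableSpace E] [BorelSpace E] [Zero E]
    {s : Set X} {f : X → E} (hs : IsOpen s) (hf : ContinuousOn f s) :
    Measurable (s.indicator f) := by
  classical
  rw [← piecewise_eq_indicator]
  exact hf.measurable_piecewise continuousOn_const hs.measurableSet

section CutoffWeight

variable {ω : ℂ → ℝ≥0∞} {n r δ : ℝ}

lemma lintegral_mul_cutoffWeight_ne_top {p : ℂ → ℝ≥0∞} {C : ℝ≥0∞} (hn : 0 ≤ n) (hr : 0 ≤ r)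
    (hC : C ≠ ∞) (hp : ∀ a ∈ ball (0 : ℂ) r, p a ≤ C) :
    ∫⁻ a, p a * cutoffWeight ω n r a ≠ ∞ := by
  refine ne_top_of_le_ne_top (b := ∫⁻ _ in ball (0 : ℂ) r, C * ENNReal.ofReal (n * r ^ 2)) ?_ ?_
  · rw [setLIntegral_const]
    exact ENNReal.mul_ne_top (by finiteness) measure_ball_lt_top.ne
  · rw [← lintegral_indicator measurableSet_ball]
    refine lintegral_mono fun a => ?_
    by_cases ha : a ∈ ball (0 : ℂ) r
    · rw [indicator_of_mem ha]
      exact mul_le_mul' (hp a ha) (cutoffWeight_le_const hn)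
    · rw [mem_ball_zero_iff, not_lt] at ha
      rw [cutoffWeight_eq_zero hn hr ha, mul_zero]
      exact zero_le

lemma lintegral_mul_cutoffWeight_le (p : ℂ → ℝ≥0∞) (hn : 0 ≤ n) (hr : r ∈ Icc (0 : ℝ) 1) :
    ∫⁻ a, p a * cutoffWeight ω n r a ≤ ∫⁻ a in ball (0 : ℂ) 1, p a * ω a := by
  rw [← lintegral_indicator measurableSet_ball]
  refine lintegral_mono fun a => ?_
  by_cases ha : a ∈ ball (0 : ℂ) 1
  · rw [indicator_of_mem ha]
    gcongr
    exact cutoffWeight_le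
  · rw [mem_ball_zero_iff, not_lt] at ha
    rw [cutoffWeight_eq_zero hn hr.1 (hr.2.trans ha), mul_zero]
    exact zero_le

namespace IsPosSuperharmonicOn

variable (hω : IsPosSuperharmonicOn ω (ball 0 1))
include hω

lemma lintegral_circleLIntegral_mul_cutoffWeight_le {p : ℂ → ℝ≥0∞} (hp : Measurable p)
    (hn : 0 ≤ n) (hδ : 0 < δ) (hr : 0 ≤ r) (hrδ : r + 2 * δ ≤ 1) {η : ℝ≥0∞}
    (hη : ∀ ρ ∈ Ioo (r - δ) (r + δ), circleLIntegral p 0 ρ ≤ η) :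
    ∫⁻ a, circleLIntegral p a δ * cutoffWeight ω n r a ≤
      ((∫⁻ a, p a * cutoffWeight ω n r a) + ENNReal.ofReal δ ^ 2 * (ENNReal.ofReal (4 * n) * η)) *
        ENNReal.ofReal (2 * π) := by
  have hW : Measurable (cutoffWeight ω n r) := hω.measurable_cutoffWeight hn ⟨hr, by linarith⟩
  set A : Set ℂ := norm ⁻¹' Ioo (r - δ) (r + δ)
  have hA : MeasurableSet A := measurableSet_Ioo.preimage measurable_norm
  calc ∫⁻ a, circleLIntegral p a δ * cutoffWeight ω n r a
      = ∫⁻ b, p b * circleLIntegral (cutoffWeight ω n r) b δ := by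
        simp only [← lintegral_mul_circleLIntegral_comm hp hW, mul_comm]
    _ ≤ ∫⁻ b, (p b * cutoffWeight ω n r b + A.indicator p b * ENNReal.ofReal (n * (2 * δ))) *
          ENNReal.ofReal (2 * π) := by
        refine lintegral_mono fun b => ?_
        refine (mul_le_mul_right (hω.circleLIntegral_cutoffWeight_le hn hr hδ hrδ b) _).trans ?_
        rw [← mul_assoc, mul_add]
        by_cases hb : b ∈ A
        · simp only [indicator_of_mem hb, A, le_refl]
        · simp only [indicator_of_notMem hb, A, mul_zero, zero_mul, le_refl]
    _ = ((∫⁻ a, p a * cutoffWeight ω n r a) + (∫⁻ a in A, p a) * ENNReal.ofReal (n * (2 * δ))) *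
          ENNReal.ofReal (2 * π) := by
        rw [lintegral_mul_const' _ _ ENNReal.ofReal_ne_top,
          lintegral_add_left (f := fun a => p a * cutoffWeight ω n r a) (hp.mul hW),
          lintegral_mul_const' _ _ ENNReal.ofReal_ne_top, lintegral_indicator hA]
    _ ≤ ((∫⁻ a, p a * cutoffWeight ω n r a) + ENNReal.ofReal (r + δ - (r - δ)) * η *
          ENNReal.ofReal (n * (2 * δ))) * ENNReal.ofReal (2 * π) := by
        gcongr
        exact setLIntegral_annulus_le hp (by linarith) hη
    _ = _ := by
        have hconst : ENNReal.ofReal (r + δ - (r - δ)) * ENNReal.ofReal (n * (2 * δ)) =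
            ENNReal.ofReal δ ^ 2 * ENNReal.ofReal (4 * n) := by
          rw [← ENNReal.ofReal_mul (by linarith), ← ENNReal.ofReal_pow hδ.le,
            ← ENNReal.ofReal_mul (by positivity)]
          congr 1
          ring
        rw [mul_right_comm _ η, hconst, mul_assoc (ENNReal.ofReal δ ^ 2)]

variable {E F : Type*} [NormedAddCommGroup E] [InnerProductSpace ℂ E] [CompleteSpace E]
  [MeasurableSpace E] [BorelSpace E] [SecondCountableTopology E]
  [NormedAddCommGroup F] [InnerProductSpace ℂ F] [CompleteSpace F]
  [MeasurableSpace F] [BorelSpace F] [SecondCountableTopology F] {u : ℂ → E} {v : ℂ → F}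

lemma tendsto_lintegral_circleSlope_mul_cutoffWeight (hum : Measurable u)
    (hu : DifferentiableOn ℂ u (ball 0 1)) (hn : 0 ≤ n) (hr : r ∈ Ico (0 : ℝ) 1) :
    Tendsto (fun δ => ∫⁻ a, circleSlope u δ a * cutoffWeight ω n r a) (𝓝[>] 0)
      (𝓝 ((∫⁻ a, ‖deriv u a‖ₑ ^ 2 * cutoffWeight ω n r a) * ENNReal.ofReal (2 * π))) := by
  have hW : Measurable (cutoffWeight ω n r) :=
    hω.measurable_cutoffWeight hn (Ico_subset_Icc_self hr)
  obtain ⟨C, hC, hbound⟩ := exists_circleSlope_le hu hr.2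
  rw [← lintegral_mul_const' _ _ ENNReal.ofReal_ne_top]
  simp only [mul_right_comm _ (cutoffWeight ω n r _) (ENNReal.ofReal (2 * π))]
  refine tendsto_lintegral_filter_of_dominated_convergence (fun a => C * cutoffWeight ω n r a)
    (Eventually.of_forall fun δ => (measurable_circleSlope hum δ).mul hW) ?_
    (lintegral_mul_cutoffWeight_ne_top hn hr.1 hC fun _ _ => le_rfl)
    (Eventually.of_forall fun a => ?_)
  · filter_upwards [hbound] with δ hδ
    refine Eventually.of_forall fun a => ?_
    by_cases ha : a ∈ ball (0 : ℂ) r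
    · gcongr
      exact hδ a ha
    · rw [mem_ball_zero_iff, not_lt] at ha
      simp only [cutoffWeight_eq_zero hn hr.1 ha, mul_zero, le_refl]
  · by_cases ha : a ∈ ball (0 : ℂ) r
    · have hderiv := (hu.differentiableAt
        (isOpen_ball.mem_nhds (ball_subset_ball hr.2.le ha))).hasDerivAt.tendsto_slope
      exact ENNReal.Tendsto.mul_const
        (tendsto_circleLIntegral (ENNReal.Tendsto.pow hderiv.enorm))
        (Or.inr (ne_top_of_le_ne_top ENNReal.ofReal_ne_top (cutoffWeight_le_const hn)))
    · rw [mem_ball_zero_iff, not_lt] at ha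
      simp only [cutoffWeight_eq_zero hn hr.1 ha, mul_zero, tendsto_const_nhds_iff]

section Comparison

variable (hum : Measurable u) (hu : DifferentiableOn ℂ u (ball 0 1)) (hvm : Measurable v)
  (hv : DifferentiableOn ℂ v (ball 0 1)) (huv : ∀ z ∈ ball (0 : ℂ) 1, ‖u z‖ ≤ ‖v z‖)
include hum hu hvm hv huv

omit [SecondCountableTopology F] in
lemma lintegral_circleSlope_mul_cutoffWeight_add (hn : 0 ≤ n) (hδ : 0 < δ) (hr : 0 ≤ r)
    (hrδ : r + δ ≤ 1) :
    ENNReal.ofReal δ ^ 2 * (∫⁻ a, circleSlope u δ a * cutoffWeight ω n r a) +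
        ∫⁻ a, circleLIntegral (normSqGap u v) a δ * cutoffWeight ω n r a =
      (∫⁻ a, normSqGap u v a * cutoffWeight ω n r a) * ENNReal.ofReal (2 * π) +
        ENNReal.ofReal δ ^ 2 * ∫⁻ a, circleSlope v δ a * cutoffWeight ω n r a := by
  have hW : Measurable (cutoffWeight ω n r) := hω.measurable_cutoffWeight hn ⟨hr, by linarith⟩
  have hgap : Measurable (normSqGap u v) := (hvm.enorm.pow_const 2).sub (hum.enorm.pow_const 2)
  have hslope : Measurable fun a => ENNReal.ofReal δ ^ 2 *
      (circleSlope u δ a * cutoffWeight ω n r a) :=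
    ((measurable_circleSlope hum δ).mul hW).const_mul _
  rw [← lintegral_mul_const' _ _ ENNReal.ofReal_ne_top, ← lintegral_const_mul' _ _ (by finiteness),
    ← lintegral_const_mul' _ _ (by finiteness), ← lintegral_add_left hslope,
    ← lintegral_add_left (f := fun a => normSqGap u v a * cutoffWeight ω n r a *
      ENNReal.ofReal (2 * π)) ((hgap.mul hW).mul_const _)]
  refine lintegral_congr fun a => ?_
  by_cases ha : a ∈ ball (0 : ℂ) r
  · have hsub : closedBall a δ ⊆ ball (0 : ℂ) 1 := closedBall_subset_ball' (by
      rw [mem_ball] at ha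
      linarith)
    simp only [mul_right_comm _ (cutoffWeight ω n r a), ← mul_assoc, ← add_mul]
    rw [circleLIntegral_normSqGap hum hδ (hu.mono hsub) (hv.mono hsub)
      fun z hz => huv z (hsub hz)]
  · rw [mem_ball_zero_iff, not_lt] at ha
    simp only [cutoffWeight_eq_zero hn hr ha, mul_zero, zero_mul, add_zero]

omit [SecondCountableTopology F] in
lemma lintegral_circleSlope_mul_cutoffWeight_le (hn : 0 ≤ n) (hδ : 0 < δ) (hr : 0 ≤ r)
    (hrδ : r + 2 * δ ≤ 1) {η : ℝ≥0∞}
    (hη : ∀ ρ ∈ Ioo (r - δ) (r + δ), circleLIntegral (normSqGap u v) 0 ρ ≤ η) :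
    ∫⁻ a, circleSlope v δ a * cutoffWeight ω n r a ≤
      (∫⁻ a, circleSlope u δ a * cutoffWeight ω n r a) +
        ENNReal.ofReal (4 * n) * η * ENNReal.ofReal (2 * π) := by
  have hgap : Measurable (normSqGap u v) := (hvm.enorm.pow_const 2).sub (hum.enorm.pow_const 2)
  have hfin : ∫⁻ a, normSqGap u v a * cutoffWeight ω n r a ≠ ∞ := by
    obtain ⟨C, hC⟩ := (isCompact_closedBall (0 : ℂ) r).exists_bound_of_continuousOn
      (hv.continuousOn.mono (closedBall_subset_ball (by linarith)))
    refine lintegral_mul_cutoffWeight_ne_top hn hr (C := ENNReal.ofReal C ^ 2) (by finiteness)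
      fun a ha => tsub_le_self.trans ?_
    rw [← ofReal_norm]
    gcongr
    exact hC a (ball_subset_closedBall ha)
  have hmul : ENNReal.ofReal δ ^ 2 * ∫⁻ a, circleSlope v δ a * cutoffWeight ω n r a ≤
      ENNReal.ofReal δ ^ 2 * ((∫⁻ a, circleSlope u δ a * cutoffWeight ω n r a) +
        ENNReal.ofReal (4 * n) * η * ENNReal.ofReal (2 * π)) := by
    refine (ENNReal.add_le_add_iff_left (ENNReal.mul_ne_top hfin
      (ENNReal.ofReal_ne_top (r := 2 * π)))).1 ?_
    rw [← hω.lintegral_circleSlope_mul_cutoffWeight_add hum hu hvm hv huv hn hδ hr (by linarith)]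
    refine (add_le_add_right (hω.lintegral_circleLIntegral_mul_cutoffWeight_le hgap hn hδ hr hrδ hη)
      _).trans_eq ?_
    ring
  exact (ENNReal.mul_le_mul_iff_right (by simpa using hδ) (by finiteness)).1 hmul

lemma lintegral_enorm_deriv_sq_mul_cutoffWeight_le (hn : 0 ≤ n) (hr : r ∈ Ico (0 : ℝ) 1) {η : ℝ≥0∞}
    (hη : ∀ᶠ ρ in 𝓝 r, circleLIntegral (normSqGap u v) 0 ρ ≤ η) :
    ∫⁻ a, ‖deriv v a‖ₑ ^ 2 * cutoffWeight ω n r a ≤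
      (∫⁻ a, ‖deriv u a‖ₑ ^ 2 * cutoffWeight ω n r a) + ENNReal.ofReal (4 * n) * η := by
  obtain ⟨ε, hε, hball⟩ := Metric.eventually_nhds_iff_ball.1 hη
  have hlim : (∫⁻ a, ‖deriv v a‖ₑ ^ 2 * cutoffWeight ω n r a) * ENNReal.ofReal (2 * π) ≤
      (∫⁻ a, ‖deriv u a‖ₑ ^ 2 * cutoffWeight ω n r a) * ENNReal.ofReal (2 * π) +
        ENNReal.ofReal (4 * n) * η * ENNReal.ofReal (2 * π) := by
    refine le_of_tendsto_of_tendsto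
      (hω.tendsto_lintegral_circleSlope_mul_cutoffWeight hvm hv hn hr)
      ((hω.tendsto_lintegral_circleSlope_mul_cutoffWeight hum hu hn hr).add_const _) ?_
    filter_upwards [Ioo_mem_nhdsGT hε, Ioo_mem_nhdsGT (half_pos (sub_pos.2 hr.2))] with δ hδε hδr
    refine hω.lintegral_circleSlope_mul_cutoffWeight_le hum hu hvm hv huv hn hδε.1 hr.1
      (by linarith [hδr.2]) fun ρ hρ => hball ρ ?_
    rw [Real.ball_eq_Ioo]
    exact Ioo_subset_Ioo (by linarith [hδε.2]) (by linarith [hδε.2]) hρ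
  rw [← add_mul] at hlim
  exact (ENNReal.mul_le_mul_iff_left (by simp [pi_pos]) ENNReal.ofReal_ne_top).1 hlim

lemma lintegral_enorm_deriv_sq_mul_le_of_measurable
    (hgap : Tendsto (circleLIntegral (normSqGap u v) 0) (𝓝[<] 1) (𝓝 0)) :
    ∫⁻ a in ball (0 : ℂ) 1, ‖deriv v a‖ₑ ^ 2 * ω a ≤
      ∫⁻ a in ball (0 : ℂ) 1, ‖deriv u a‖ₑ ^ 2 * ω a := by
  refine le_of_forall_pos_le_add fun ε hε => ?_
  have hbound (k : ℕ) : ∀ᶠ r in 𝓝[<] 1, r ∈ Ioo (1 - 1 / ((k : ℝ) + 1)) 1 ∧ 0 ≤ r ∧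
      ∫⁻ a, ‖deriv v a‖ₑ ^ 2 * cutoffWeight ω k r a ≤
        (∫⁻ a in ball (0 : ℂ) 1, ‖deriv u a‖ₑ ^ 2 * ω a) + ε := by
    have hsmall := hgap.eventually (ge_mem_nhds (ENNReal.div_pos hε.ne'
      (ENNReal.ofReal_ne_top (r := 4 * k))))
    filter_upwards [Ioo_mem_nhdsLT (sub_lt_self 1 (Nat.one_div_pos_of_nat (n := k))),
      Ioo_mem_nhdsLT zero_lt_one, eventually_eventually_nhdsWithin.2 hsmall] with r hrk hr hη
    rw [isOpen_Iio.nhdsWithin_eq hr.2] at hη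
    refine ⟨hrk, hr.1.le, ?_⟩
    refine (hω.lintegral_enorm_deriv_sq_mul_cutoffWeight_le hum hu hvm hv huv k.cast_nonneg
      ⟨hr.1.le, hr.2⟩ hη).trans ?_
    exact add_le_add (lintegral_mul_cutoffWeight_le _ k.cast_nonneg ⟨hr.1.le, hr.2.le⟩)
      ENNReal.mul_div_le
  choose x hx hx0 hle using fun k => (hbound k).exists
  have hx1 : Tendsto x atTop (𝓝 1) := by
    refine tendsto_of_tendsto_of_tendsto_of_le_of_le ?_ tendsto_const_nhds (fun k => (hx k).1.le)
      fun k => (hx k).2.le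
    simpa only [sub_zero] using tendsto_one_div_add_atTop_nhds_zero_nat.const_sub (1 : ℝ)
  have hmeas (k : ℕ) : Measurable fun a => ‖deriv v a‖ₑ ^ 2 * cutoffWeight ω k (x k) a :=
    ((measurable_deriv v).enorm.pow_const 2).mul
      (hω.measurable_cutoffWeight k.cast_nonneg ⟨hx0 k, (hx k).2.le⟩)
  calc ∫⁻ a in ball (0 : ℂ) 1, ‖deriv v a‖ₑ ^ 2 * ω a
      = ∫⁻ a in ball (0 : ℂ) 1,
          liminf (fun k : ℕ => ‖deriv v a‖ₑ ^ 2 * cutoffWeight ω k (x k) a) atTop :=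
        setLIntegral_congr_fun measurableSet_ball fun a ha =>
          (ENNReal.Tendsto.const_mul (tendsto_cutoffWeight hx1 ha)
            (Or.inr (by finiteness))).liminf_eq.symm
    _ ≤ liminf (fun k : ℕ => ∫⁻ a in ball (0 : ℂ) 1,
          ‖deriv v a‖ₑ ^ 2 * cutoffWeight ω k (x k) a) atTop := lintegral_liminf_le hmeas
    _ ≤ (∫⁻ a in ball (0 : ℂ) 1, ‖deriv u a‖ₑ ^ 2 * ω a) + ε :=
        liminf_le_of_frequently_le' (Frequently.of_forall fun k =>
          (setLIntegral_le_lintegral _ _).trans (hle k))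

end Comparison

omit [MeasurableSpace E] [BorelSpace E] [MeasurableSpace F] [BorelSpace F] in
theorem lintegral_enorm_deriv_sq_mul_le (hu : DifferentiableOn ℂ u (ball 0 1))
    (hv : DifferentiableOn ℂ v (ball 0 1)) (huv : ∀ z ∈ ball (0 : ℂ) 1, ‖u z‖ ≤ ‖v z‖)
    {l : ℝ≥0∞} (hl : l ≠ ∞)
    (hul : Tendsto (circleLIntegral (fun z => ‖u z‖ₑ ^ 2) 0) (𝓝[<] 1) (𝓝 l))
    (hvl : Tendsto (circleLIntegral (fun z => ‖v z‖ₑ ^ 2) 0) (𝓝[<] 1) (𝓝 l)) :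
    ∫⁻ a in ball (0 : ℂ) 1, ‖deriv v a‖ₑ ^ 2 * ω a ≤
      ∫⁻ a in ball (0 : ℂ) 1, ‖deriv u a‖ₑ ^ 2 * ω a := by
  borelize E F
  have hum := measurable_indicator_of_isOpen isOpen_ball hu.continuousOn
  have hvm := measurable_indicator_of_isOpen isOpen_ball hv.continuousOn
  set u' : ℂ → E := (ball 0 1).indicator u
  set v' : ℂ → F := (ball 0 1).indicator v
  have hu' : EqOn u' u (ball 0 1) := eqOn_indicator
  have hv' : EqOn v' v (ball 0 1) := eqOn_indicator
  have huv' (z : ℂ) (hz : z ∈ ball (0 : ℂ) 1) : ‖u' z‖ ≤ ‖v' z‖ := by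
    rw [hu' hz, hv' hz]
    exact huv z hz
  have hgap : Tendsto (circleLIntegral (normSqGap u' v') 0) (𝓝[<] 1) (𝓝 0) := by
    rw [← tsub_self l]
    refine (ENNReal.Tendsto.sub hvl hul (Or.inl hl)).congr' ?_
    filter_upwards [Ioo_mem_nhdsLT zero_lt_one, hul.eventually_ne hl] with r hr hfin
    refine ENNReal.sub_eq_of_eq_add_rev hfin ?_
    calc circleLIntegral (fun z => ‖v z‖ₑ ^ 2) 0 r
        = circleLIntegral (fun z => ‖u' z‖ₑ ^ 2 + normSqGap u' v' z) 0 r :=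
          circleLIntegral_congr fun θ => by
            have hz := circleMap_zero_mem_ball hr θ
            rw [← hv' hz, enorm_sq_eq_add_normSqGap (huv' _ hz)]
      _ = circleLIntegral (fun z => ‖u z‖ₑ ^ 2) 0 r + circleLIntegral (normSqGap u' v') 0 r := by
          rw [circleLIntegral_add (hum.enorm.pow_const 2)]
          congr 1
          exact circleLIntegral_congr fun θ => by rw [hu' (circleMap_zero_mem_ball hr θ)]
  calc ∫⁻ a in ball (0 : ℂ) 1, ‖deriv v a‖ₑ ^ 2 * ω a
      = ∫⁻ a in ball (0 : ℂ) 1, ‖deriv v' a‖ₑ ^ 2 * ω a :=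
        setLIntegral_congr_fun measurableSet_ball fun a ha => by
          rw [hv'.deriv isOpen_ball ha]
    _ ≤ ∫⁻ a in ball (0 : ℂ) 1, ‖deriv u' a‖ₑ ^ 2 * ω a :=
        hω.lintegral_enorm_deriv_sq_mul_le_of_measurable hum (hu.congr hu') hvm (hv.congr hv') huv'
          hgap
    _ = ∫⁻ a in ball (0 : ℂ) 1, ‖deriv u a‖ₑ ^ 2 * ω a :=
        setLIntegral_congr_fun measurableSet_ball fun a ha => by
          rw [hu'.deriv isOpen_ball ha]

end IsPosSuperharmonicOn

end CutoffWeight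

/-! ### Families of outer functions -/

/-- The vector-valued function with components `√wᵢ · outerExp hᵢ`, through which the comparison
principle is applied to finite families of outer functions. -/
noncomputable def outerVector {ι : Type*} (w : ι → ℝ≥0) (h : ι → ℂ → ℝ) (z : ℂ) :
    EuclideanSpace ℂ ι :=
  WithLp.toLp 2 fun i => (√(w i) : ℂ) * outerExp (h i) z

section OuterVector

variable {ι : Type*} (w : ι → ℝ≥0) {h : ι → ℂ → ℝ}

lemma differentiableOn_outerVector [Finite ι] (hh : ∀ i, CircleIntegrable (h i) 0 1) :
    DifferentiableOn ℂ (outerVector w h) (ball 0 1) := by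
  cases nonempty_fintype ι
  exact differentiableOn_euclidean.2 fun i => (differentiableOn_outerExp (hh i)).const_mul _

variable [Fintype ι]

lemma enorm_sq_eq_sum (x : EuclideanSpace ℂ ι) : ‖x‖ₑ ^ 2 = ∑ i, ‖x i‖ₑ ^ 2 := by
  simp only [enorm_sq_eq_ofReal, EuclideanSpace.norm_sq_eq]
  exact ENNReal.ofReal_sum_of_nonneg fun i _ => by positivity

lemma enorm_ofReal_sqrt_sq (x : ℝ≥0) : ‖(√x : ℂ)‖ₑ ^ 2 = x := by
  rw [enorm_sq_eq_ofReal, Complex.norm_real, norm_of_nonneg (sqrt_nonneg _), sq_sqrt x.coe_nonneg,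
    ENNReal.ofReal_coe_nnreal]

lemma norm_outerVector_sq (h : ι → ℂ → ℝ) (z : ℂ) :
    ‖outerVector w h z‖ ^ 2 = ∑ i, w i * ‖outerExp (h i) z‖ ^ 2 := by
  rw [EuclideanSpace.norm_sq_eq]
  refine Finset.sum_congr rfl fun i _ => ?_
  rw [outerVector, norm_mul, mul_pow, Complex.norm_real, norm_of_nonneg (sqrt_nonneg _),
    sq_sqrt (w i).coe_nonneg]

lemma enorm_outerVector_sq (h : ι → ℂ → ℝ) (z : ℂ) :
    ‖outerVector w h z‖ₑ ^ 2 = ∑ i, w i * ‖outerExp (h i) z‖ₑ ^ 2 := by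
  simp only [enorm_sq_eq_sum, outerVector, enorm_mul, mul_pow, enorm_ofReal_sqrt_sq]

lemma enorm_deriv_outerVector_sq (hh : ∀ i, CircleIntegrable (h i) 0 1) {z : ℂ}
    (hz : z ∈ ball (0 : ℂ) 1) :
    ‖deriv (outerVector w h) z‖ₑ ^ 2 = ∑ i, w i * ‖deriv (outerExp (h i)) z‖ₑ ^ 2 := by
  have hd := ((differentiableOn_outerVector w hh).differentiableAt
    (isOpen_ball.mem_nhds hz)).hasDerivAt
  rw [enorm_sq_eq_sum]
  refine Finset.sum_congr rfl fun i _ => ?_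
  have hcoord : deriv (outerVector w h) z i = (√(w i) : ℂ) * deriv (outerExp (h i)) z := by
    rw [← deriv_const_mul_field]
    exact ((EuclideanSpace.proj i : _ →L[ℂ] ℂ).hasFDerivAt.comp_hasDerivAt z hd).deriv.symm
  rw [hcoord, enorm_mul, mul_pow, enorm_ofReal_sqrt_sq]

lemma tendsto_circleLIntegral_enorm_sq_outerVector (hh : ∀ i, CircleIntegrable (h i) 0 1)
    (he : ∀ i, CircleIntegrable (fun ζ => exp (2 * h i ζ)) 0 1) :
    Tendsto (circleLIntegral (fun z => ‖outerVector w h z‖ₑ ^ 2) 0) (𝓝[<] 1)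
      (𝓝 (ENNReal.ofReal (2 * π * circleAverage (fun ζ => ∑ i, w i * exp (2 * h i ζ)) 0 1))) := by
  have hterm (i : ι) : CircleIntegrable (fun ζ => w i * exp (2 * h i ζ)) 0 1 :=
    (he i).const_smul (a := (w i : ℝ))
  have hlim : ENNReal.ofReal (2 * π * circleAverage (fun ζ => ∑ i, w i * exp (2 * h i ζ)) 0 1) =
      ∑ i, w i * circleLIntegral (fun ζ => ENNReal.ofReal (exp (2 * h i ζ))) 0 1 := by
    rw [circleAverage_fun_sum fun i _ => hterm i, Finset.mul_sum, ENNReal.ofReal_sum_of_nonneg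
      fun i _ => mul_nonneg two_pi_pos.le (circleAverage_nonneg_of_nonneg fun ζ _ => by positivity)]
    refine Finset.sum_congr rfl fun i _ => ?_
    rw [circleLIntegral_ofReal (he i) fun θ => (exp_pos _).le, ← ENNReal.ofReal_coe_nnreal,
      ← ENNReal.ofReal_mul (w i).coe_nonneg]
    simp only [← smul_eq_mul (w i : ℝ), circleAverage_fun_smul]
    congr 1
    simp only [smul_eq_mul]
    ring
  rw [hlim]
  refine (tendsto_finsetSum _ fun i _ => ENNReal.Tendsto.const_mul
    (tendsto_circleLIntegral_enorm_sq_outerExp (hh i) (he i)) (Or.inr (by finiteness))).congr' ?_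
  filter_upwards [Ioo_mem_nhdsLT zero_lt_one] with r hr
  have hcont (i : ι) : Continuous fun θ => outerExp (h i) (circleMap 0 r θ) :=
    (differentiableOn_outerExp (hh i)).continuousOn.comp_continuous (continuous_circleMap 0 r)
      (circleMap_zero_mem_ball hr)
  simp only [enorm_outerVector_sq, circleLIntegral]
  rw [lintegral_finsetSum _ fun i _ => ((hcont i).measurable.enorm.pow_const 2).const_mul _]
  exact Finset.sum_congr rfl fun i _ => (lintegral_const_mul' _ _ (by finiteness)).symm

end OuterVector

section Comparison

variable {ω : ℂ → ℝ≥0∞} (hω : IsPosSuperharmonicOn ω (ball 0 1))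
include hω

lemma IsPosSuperharmonicOn.lintegral_enorm_deriv_outerVector_sq_mul {ι : Type*} [Fintype ι]
    (w : ι → ℝ≥0) {h : ι → ℂ → ℝ} (hh : ∀ i, CircleIntegrable (h i) 0 1) :
    (∫⁻ z in ball (0 : ℂ) 1, ‖deriv (outerVector w h) z‖ₑ ^ 2 * ω z) / ENNReal.ofReal π =
      ∑ i, w i * dirichletIntegral ω (outerExp (h i)) := by
  have hωm : AEMeasurable ω (volume.restrict (ball 0 1)) :=
    (aemeasurable_indicator_iff measurableSet_ball).1
      (hω.measurable_indicator isOpen_ball).aemeasurable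
  have hderiv (i : ι) : Measurable fun z => ‖deriv (outerExp (h i)) z‖ₑ ^ 2 :=
    (measurable_deriv _).enorm.pow_const 2
  simp only [dirichletIntegral, div_eq_mul_inv, ← mul_assoc]
  rw [← Finset.sum_mul]
  congr 1
  calc ∫⁻ z in ball (0 : ℂ) 1, ‖deriv (outerVector w h) z‖ₑ ^ 2 * ω z
      = ∫⁻ z in ball (0 : ℂ) 1, ∑ i, w i * (‖deriv (outerExp (h i)) z‖ₑ ^ 2 * ω z) :=
        setLIntegral_congr_fun measurableSet_ball fun z hz => by
          simp only [enorm_deriv_outerVector_sq w hh hz, Finset.sum_mul, mul_assoc]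
    _ = ∑ i, w i * ∫⁻ z in ball (0 : ℂ) 1, ‖deriv (outerExp (h i)) z‖ₑ ^ 2 * ω z := by
        rw [lintegral_finsetSum' _ fun i _ => ((hderiv i).aemeasurable.fun_mul hωm).const_mul _]
        exact Finset.sum_congr rfl fun i _ => lintegral_const_mul' _ _ (by finiteness)

theorem IsPosSuperharmonicOn.sum_dirichletIntegral_outerExp_le {ι κ : Type*} [Fintype ι] [Fintype κ]
    (w : ι → ℝ≥0) (w' : κ → ℝ≥0) {a : ι → ℂ → ℝ} {b : κ → ℂ → ℝ}
    (ha : ∀ i, CircleIntegrable (a i) 0 1) (hb : ∀ j, CircleIntegrable (b j) 0 1)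
    (hea : ∀ i, CircleIntegrable (fun ζ => exp (2 * a i ζ)) 0 1)
    (heb : ∀ j, CircleIntegrable (fun ζ => exp (2 * b j ζ)) 0 1)
    (hboundary : ∀ ζ, ∑ i, w i * exp (2 * a i ζ) = ∑ j, w' j * exp (2 * b j ζ))
    (hle : ∀ z ∈ ball (0 : ℂ) 1,
      ∑ i, w i * ‖outerExp (a i) z‖ ^ 2 ≤ ∑ j, w' j * ‖outerExp (b j) z‖ ^ 2) :
    ∑ j, w' j * dirichletIntegral ω (outerExp (b j)) ≤
      ∑ i, w i * dirichletIntegral ω (outerExp (a i)) := by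
  rw [← hω.lintegral_enorm_deriv_outerVector_sq_mul w ha,
    ← hω.lintegral_enorm_deriv_outerVector_sq_mul w' hb]
  gcongr ?_ / _
  have hlim := tendsto_circleLIntegral_enorm_sq_outerVector w ha hea
  simp only [hboundary] at hlim
  refine hω.lintegral_enorm_deriv_sq_mul_le (differentiableOn_outerVector w ha)
    (differentiableOn_outerVector w' hb) (fun z hz => ?_) ENNReal.ofReal_ne_top hlim
    (tendsto_circleLIntegral_enorm_sq_outerVector w' hb heb)
  rw [← sq_le_sq₀ (norm_nonneg _) (norm_nonneg _), norm_outerVector_sq, norm_outerVector_sq]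
  exact hle z hz

end Comparison

/-! ### Lattice operations on boundary moduli -/

section CircleIntegrable

variable {a b m : ℂ → ℝ}

lemma circleIntegrable_zero : CircleIntegrable (0 : ℂ → ℝ) 0 1 :=
  circleIntegrable_const 0 0 1

lemma circleIntegrable_sup (ha : CircleIntegrable a 0 1) (hb : CircleIntegrable b 0 1) :
    CircleIntegrable (a ⊔ b) 0 1 := by
  simp only [CircleIntegrable, intervalIntegrable_iff] at *
  exact Integrable.sup ha hb

lemma circleIntegrable_inf (ha : CircleIntegrable a 0 1) (hb : CircleIntegrable b 0 1) :
    CircleIntegrable (a ⊓ b) 0 1 := by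
  simp only [CircleIntegrable, intervalIntegrable_iff] at *
  exact Integrable.inf ha hb

lemma circleIntegrable_exp_sup (ha : CircleIntegrable (fun ζ => exp (2 * a ζ)) 0 1)
    (hb : CircleIntegrable (fun ζ => exp (2 * b ζ)) 0 1) :
    CircleIntegrable (fun ζ => exp (2 * (a ⊔ b) ζ)) 0 1 := by
  convert circleIntegrable_sup ha hb using 1
  ext ζ
  rw [Pi.sup_apply, Pi.sup_apply, mul_max_of_nonneg _ _ zero_le_two, exp_monotone.map_max]

lemma circleIntegrable_exp_inf (ha : CircleIntegrable (fun ζ => exp (2 * a ζ)) 0 1)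
    (hb : CircleIntegrable (fun ζ => exp (2 * b ζ)) 0 1) :
    CircleIntegrable (fun ζ => exp (2 * (a ⊓ b) ζ)) 0 1 := by
  convert circleIntegrable_inf ha hb using 1
  ext ζ
  rw [Pi.inf_apply, Pi.inf_apply, mul_min_of_nonneg _ _ zero_le_two, exp_monotone.map_min]

lemma circleIntegrable_exp_add_of_nonpos (ha : CircleIntegrable (fun ζ => exp (2 * a ζ)) 0 1)
    (hm : CircleIntegrable (fun ζ => exp (2 * m ζ)) 0 1) (hm0 : m ≤ 0) :
    CircleIntegrable (fun ζ => exp (2 * (a + m) ζ)) 0 1 := by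
  simp only [CircleIntegrable, intervalIntegrable_iff, Pi.add_apply, mul_add, exp_add] at *
  refine Integrable.mono' ha (ha.1.mul hm.1) (Eventually.of_forall fun θ => ?_)
  rw [norm_of_nonneg (by positivity)]
  refine mul_le_of_le_one_right (exp_pos _).le (exp_le_one_iff.2 ?_)
  linarith [show m (circleMap 0 1 θ) ≤ 0 from hm0 _]

end CircleIntegrable

section OuterNorm

variable {a b : ℂ → ℝ} {z : ℂ}

lemma norm_outerExp_le_one (ha : CircleIntegrable a 0 1) (ha0 : a ≤ 0)
    (hz : z ∈ ball (0 : ℂ) 1) : ‖outerExp a z‖ ≤ 1 := by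
  simpa using norm_outerExp_mono ha circleIntegrable_zero ha0 hz

lemma one_le_norm_outerExp (ha : CircleIntegrable a 0 1) (ha0 : 0 ≤ a)
    (hz : z ∈ ball (0 : ℂ) 1) : 1 ≤ ‖outerExp a z‖ := by
  simpa using norm_outerExp_mono circleIntegrable_zero ha ha0 hz

lemma outerExp_inf_mul_sup (ha : CircleIntegrable a 0 1) (hb : CircleIntegrable b 0 1)
    (hz : z ∈ ball (0 : ℂ) 1) :
    outerExp (a ⊓ b) z * outerExp (a ⊔ b) z = outerExp a z * outerExp b z := by
  rw [← outerExp_add (circleIntegrable_inf ha hb) (circleIntegrable_sup ha hb) hz, inf_add_sup,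
    outerExp_add ha hb hz]

lemma norm_sq_add_norm_sq_outerExp_le (ha : CircleIntegrable a 0 1) (hb : CircleIntegrable b 0 1)
    (hz : z ∈ ball (0 : ℂ) 1) :
    ‖outerExp a z‖ ^ 2 + ‖outerExp b z‖ ^ 2 ≤
      ‖outerExp (a ⊔ b) z‖ ^ 2 + ‖outerExp (a ⊓ b) z‖ ^ 2 := by
  have hsup := circleIntegrable_sup ha hb
  have hxX : ‖outerExp a z‖ ≤ ‖outerExp (a ⊔ b) z‖ :=
    norm_outerExp_mono ha hsup (fun ζ => le_sup_left) hz
  have hyX : ‖outerExp b z‖ ≤ ‖outerExp (a ⊔ b) z‖ :=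
    norm_outerExp_mono hb hsup (fun ζ => le_sup_right) hz
  have hX : 0 < ‖outerExp (a ⊔ b) z‖ := norm_pos_iff.2 (Complex.exp_ne_zero _)
  have hmul := congrArg norm (outerExp_inf_mul_sup ha hb hz)
  rw [norm_mul, norm_mul] at hmul
  set x := ‖outerExp a z‖
  set y := ‖outerExp b z‖
  set X := ‖outerExp (a ⊔ b) z‖
  set Y := ‖outerExp (a ⊓ b) z‖
  have hfactor : X ^ 2 * (X ^ 2 + Y ^ 2 - (x ^ 2 + y ^ 2)) = (X ^ 2 - x ^ 2) * (X ^ 2 - y ^ 2) := by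
    linear_combination (Y * X + x * y) * hmul
  have hnonneg : 0 ≤ X ^ 2 * (X ^ 2 + Y ^ 2 - (x ^ 2 + y ^ 2)) := by
    rw [hfactor]
    exact mul_nonneg (sub_nonneg.2 (by gcongr)) (sub_nonneg.2 (by gcongr))
  exact sub_nonneg.1 (nonneg_of_mul_nonneg_right hnonneg (by positivity))

lemma norm_sq_outerExp_add_inf_zero_le (ha : CircleIntegrable a 0 1) (hz : z ∈ ball (0 : ℂ) 1) :
    4 * ‖outerExp a z‖ ^ 2 + ‖outerExp (a ⊓ 0 + a ⊓ 0) z‖ ^ 2 + 3 ≤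
      ‖outerExp (a + a ⊓ 0) z‖ ^ 2 + 3 * ‖outerExp (a ⊔ 0) z‖ ^ 2 +
        4 * ‖outerExp (a ⊓ 0) z‖ ^ 2 := by
  have hm := circleIntegrable_inf ha circleIntegrable_zero
  have hk := circleIntegrable_sup ha circleIntegrable_zero
  have hmul : ‖outerExp a z‖ = ‖outerExp (a ⊓ 0) z‖ * ‖outerExp (a ⊔ 0) z‖ := by
    rw [← norm_mul]
    simpa using congrArg norm (outerExp_inf_mul_sup ha circleIntegrable_zero hz).symm
  rw [outerExp_add hm hm hz, outerExp_add ha hm hz, norm_mul, norm_mul, hmul]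
  have hM : ‖outerExp (a ⊓ 0) z‖ ^ 2 ≤ 1 :=
    pow_le_one₀ (norm_nonneg _) (norm_outerExp_le_one hm inf_le_right hz)
  have hK : 1 ≤ ‖outerExp (a ⊔ 0) z‖ ^ 2 :=
    one_le_pow₀ (one_le_norm_outerExp hk le_sup_right hz)
  set M := ‖outerExp (a ⊓ 0) z‖
  set K := ‖outerExp (a ⊔ 0) z‖
  have hfactor : 0 ≤ (K ^ 2 - 1) * (1 - M ^ 2) * (3 - M ^ 2) :=
    mul_nonneg (mul_nonneg (by linarith) (by linarith)) (by linarith)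
  linarith

end OuterNorm

section DirichletIntegral

variable {ω : ℂ → ℝ≥0∞} {a b m : ℂ → ℝ}

lemma dirichletIntegral_one : dirichletIntegral ω 1 = 0 := by
  simp [dirichletIntegral, Pi.one_def]

lemma dirichletIntegral_outerExp_add_self_le (hm : CircleIntegrable m 0 1) (hm0 : m ≤ 0) :
    dirichletIntegral ω (outerExp (m + m)) ≤ 4 * dirichletIntegral ω (outerExp m) := by
  rw [dirichletIntegral, dirichletIntegral, ← mul_div_assoc,
    ← lintegral_const_mul' _ _ (by finiteness)]
  gcongr ?_ / _
  refine setLIntegral_mono' measurableSet_ball fun z hz => ?_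
  have hd : DifferentiableAt ℂ (outerExp m) z :=
    (differentiableOn_outerExp hm).differentiableAt (isOpen_ball.mem_nhds hz)
  have hderiv : deriv (outerExp (m + m)) z = 2 * outerExp m z * deriv (outerExp m) z := by
    have hsq : EqOn (outerExp (m + m)) (fun w => outerExp m w * outerExp m w) (ball 0 1) :=
      fun w hw => outerExp_add hm hm hw
    rw [hsq.deriv isOpen_ball hz, deriv_fun_mul hd hd]
    ring
  have hnorm : ‖deriv (outerExp (m + m)) z‖ₑ ≤ 2 * ‖deriv (outerExp m) z‖ₑ := by
    rw [← ofReal_norm, ← ofReal_norm, ← ENNReal.ofReal_ofNat 2, ← ENNReal.ofReal_mul zero_le_two,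
      hderiv, norm_mul, norm_mul, Complex.norm_two]
    gcongr
    exact mul_le_of_le_one_right zero_le_two (norm_outerExp_le_one hm hm0 hz)
  calc ‖deriv (outerExp (m + m)) z‖ₑ ^ 2 * ω z ≤ (2 * ‖deriv (outerExp m) z‖ₑ) ^ 2 * ω z := by
        gcongr
    _ = 4 * (‖deriv (outerExp m) z‖ₑ ^ 2 * ω z) := by ring

variable (hω : IsPosSuperharmonicOn ω (ball 0 1)) (ha : CircleIntegrable a 0 1)
  (hea : CircleIntegrable (fun ζ => exp (2 * a ζ)) 0 1)
include hω ha hea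

lemma IsPosSuperharmonicOn.dirichletIntegral_sup_add_inf_le (hb : CircleIntegrable b 0 1)
    (heb : CircleIntegrable (fun ζ => exp (2 * b ζ)) 0 1) :
    dirichletIntegral ω (outerExp (a ⊔ b)) + dirichletIntegral ω (outerExp (a ⊓ b)) ≤
      dirichletIntegral ω (outerExp a) + dirichletIntegral ω (outerExp b) := by
  have key := hω.sum_dirichletIntegral_outerExp_le (a := ![a, b]) (b := ![a ⊔ b, a ⊓ b]) 1 1
    (by simp [Fin.forall_fin_two, ha, hb])
    (by simp [Fin.forall_fin_two, circleIntegrable_sup ha hb, circleIntegrable_inf ha hb])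
    (Fin.forall_fin_two.2 ⟨hea, heb⟩)
    (Fin.forall_fin_two.2 ⟨circleIntegrable_exp_sup hea heb, circleIntegrable_exp_inf hea heb⟩)
    (fun ζ => ?_) (fun z hz => ?_)
  · simpa using key
  · rcases le_total (a ζ) (b ζ) with h | h <;> simp [h, add_comm]
  · simpa using norm_sq_add_norm_sq_outerExp_le ha hb hz

lemma IsPosSuperharmonicOn.dirichletIntegral_add_inf_zero_add_le :
    dirichletIntegral ω (outerExp (a + a ⊓ 0)) + 3 * dirichletIntegral ω (outerExp (a ⊔ 0)) +
        4 * dirichletIntegral ω (outerExp (a ⊓ 0)) ≤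
      4 * dirichletIntegral ω (outerExp a) + dirichletIntegral ω (outerExp (a ⊓ 0 + a ⊓ 0)) := by
  have he0 : CircleIntegrable (fun ζ => exp (2 * (0 : ℂ → ℝ) ζ)) 0 1 := by simp
  have hm := circleIntegrable_inf ha circleIntegrable_zero
  have hk := circleIntegrable_sup ha circleIntegrable_zero
  have hem := circleIntegrable_exp_inf hea he0
  have hm0 : a ⊓ 0 ≤ 0 := inf_le_right
  have hboundary (x : ℝ) : 4 * exp (2 * x) + exp (2 * (min x 0 + min x 0)) + 3 =
      exp (2 * (x + min x 0)) + 3 * exp (2 * max x 0) + 4 * exp (2 * min x 0) := by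
    rcases le_total x 0 with h | h
    · simp only [min_eq_left h, max_eq_right h, mul_zero, exp_zero]
      ring
    · simp only [min_eq_right h, max_eq_left h, add_zero, mul_zero, exp_zero]
      ring
  have key := hω.sum_dirichletIntegral_outerExp_le (a := ![a, a ⊓ 0 + a ⊓ 0, 0])
    (b := ![a + a ⊓ 0, a ⊔ 0, a ⊓ 0]) ![4, 1, 3] ![1, 3, 4]
    (fun i => by fin_cases i; exacts [ha, hm.add hm, circleIntegrable_zero])
    (fun i => by fin_cases i; exacts [ha.add hm, hk, hm])
    (fun i => by
      fin_cases i
      exacts [hea, circleIntegrable_exp_add_of_nonpos hem hem hm0, he0])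
    (fun i => by
      fin_cases i
      exacts [circleIntegrable_exp_add_of_nonpos hea hem hm0, circleIntegrable_exp_sup hea he0,
        hem])
    (fun ζ => ?_) (fun z hz => ?_)
  · simpa [Fin.sum_univ_three, dirichletIntegral_one] using key
  · simpa [Fin.sum_univ_three] using hboundary (a ζ)
  · simpa [Fin.sum_univ_three] using norm_sq_outerExp_add_inf_zero_le ha hz

lemma IsPosSuperharmonicOn.dirichletIntegral_add_inf_zero_le :
    dirichletIntegral ω (outerExp (a + a ⊓ 0)) ≤ 4 * dirichletIntegral ω (outerExp a) := by
  have hm := circleIntegrable_inf ha circleIntegrable_zero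
  rcases eq_or_ne (dirichletIntegral ω (outerExp a)) ∞ with htop | htop
  · simp [htop]
  have hm_top : dirichletIntegral ω (outerExp (a ⊓ 0)) ≠ ∞ := by
    have hle := hω.dirichletIntegral_sup_add_inf_le ha hea circleIntegrable_zero (by simp)
    rw [outerExp_zero, dirichletIntegral_one, add_zero] at hle
    exact ne_top_of_le_ne_top htop (le_add_self.trans hle)
  refine (ENNReal.add_le_add_iff_right (a := 4 * dirichletIntegral ω (outerExp (a ⊓ 0)))
    (by finiteness)).1 ?_
  calc dirichletIntegral ω (outerExp (a + a ⊓ 0)) + 4 * dirichletIntegral ω (outerExp (a ⊓ 0))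
      ≤ dirichletIntegral ω (outerExp (a + a ⊓ 0)) +
          3 * dirichletIntegral ω (outerExp (a ⊔ 0)) +
            4 * dirichletIntegral ω (outerExp (a ⊓ 0)) := by
        gcongr
        exact le_self_add
    _ ≤ 4 * dirichletIntegral ω (outerExp a) + dirichletIntegral ω (outerExp (a ⊓ 0 + a ⊓ 0)) :=
        hω.dirichletIntegral_add_inf_zero_add_le ha hea
    _ ≤ 4 * dirichletIntegral ω (outerExp a) + 4 * dirichletIntegral ω (outerExp (a ⊓ 0)) := by
        gcongr
        exact dirichletIntegral_outerExp_add_self_le hm inf_le_right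

end DirichletIntegral

/-! ### Outer functions in `H²` -/

lemma dirichletIntegral_const_mul {ω : ℂ → ℝ≥0∞} {f g : ℂ → ℂ} (α : ℂ)
    (hfg : ∀ z ∈ ball (0 : ℂ) 1, f z = α * g z) :
    dirichletIntegral ω f = ‖α‖ₑ ^ 2 * dirichletIntegral ω g := by
  rw [dirichletIntegral, dirichletIntegral, ← mul_div_assoc,
    ← lintegral_const_mul' _ _ (by finiteness)]
  congr 1
  refine setLIntegral_congr_fun measurableSet_ball fun z hz => ?_
  have hderiv : deriv f z = α * deriv g z :=
    (EqOn.deriv (g := fun z => α * g z) hfg isOpen_ball hz).trans (deriv_const_mul_field _)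
  rw [hderiv, enorm_mul, mul_pow, mul_assoc]

namespace IsOuter

lemma exists_eq_outerExp {f : ℂ → ℂ} (hf : IsOuter f) (hf2 : MemHardy 2 f) :
    ∃ a : ℂ → ℝ, CircleIntegrable a 0 1 ∧ CircleIntegrable (fun ζ => exp (2 * a ζ)) 0 1 ∧
      (∀ᵐ x : ℝ, ‖radialLimit f (circleMap 0 1 x)‖ = exp (a (circleMap 0 1 x))) ∧
      ∀ ω, dirichletIntegral ω f = dirichletIntegral ω (outerExp a) := by
  obtain ⟨-, α, a, hα, ha, hfa⟩ := hf
  have hnorm : ∀ z ∈ ball (0 : ℂ) 1, ‖f z‖ = ‖outerExp a z‖ := fun z hz => by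
    rw [hfa z hz, norm_mul, hα, one_mul]
  refine ⟨a, ha, hf2.circleIntegrable_exp ha hnorm, hf2.ae_norm_radialLimit_eq ha hnorm,
    fun ω => ?_⟩
  rw [dirichletIntegral_const_mul α hfa, ← ofReal_norm, hα, ENNReal.ofReal_one, one_pow, one_mul]

variable {ω : ℂ → ℝ≥0∞} {f g : ℂ → ℂ} (hω : IsPosSuperharmonicOn ω (ball 0 1))
include hω

lemma dirichletIntegral_outerSup_add_outerInf_le (hf : IsOuter f) (hf2 : MemHardy 2 f)
    (hg : IsOuter g) (hg2 : MemHardy 2 g) :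
    dirichletIntegral ω (outerSup f g) + dirichletIntegral ω (outerInf f g) ≤
      dirichletIntegral ω f + dirichletIntegral ω g := by
  obtain ⟨a, ha, hea, hfa, hDf⟩ := hf.exists_eq_outerExp hf2
  obtain ⟨b, hb, heb, hgb, hDg⟩ := hg.exists_eq_outerExp hg2
  have hsup : outerSup f g = outerExp (a ⊔ b) := outerExp_congr_ae <| by
    filter_upwards [hfa, hgb] with x hx hx'
    rw [hx, hx', ← exp_monotone.map_max, log_exp, Pi.sup_apply]
  have hinf : outerInf f g = outerExp (a ⊓ b) := outerExp_congr_ae <| by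
    filter_upwards [hfa, hgb] with x hx hx'
    rw [hx, hx', ← exp_monotone.map_min, log_exp, Pi.inf_apply]
  rw [hsup, hinf, hDf, hDg]
  exact hω.dirichletIntegral_sup_add_inf_le ha hea hb heb

lemma dirichletIntegral_outerInf_sq_le (hf : IsOuter f) (hf2 : MemHardy 2 f) :
    dirichletIntegral ω (outerInf f fun z => f z ^ 2) ≤ 4 * dirichletIntegral ω f := by
  obtain ⟨a, ha, hea, hfa, hDf⟩ := hf.exists_eq_outerExp hf2
  have hinf : outerInf f (fun z => f z ^ 2) = outerExp (a + a ⊓ 0) := outerExp_congr_ae <| by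
    filter_upwards [hfa, hf2.ae_radialLimit_sq_eq] with x hx hx'
    rw [hx', norm_pow, hx, ← exp_nat_mul, ← exp_monotone.map_min, log_exp, Nat.cast_two, two_mul,
      Pi.add_apply, Pi.inf_apply, ← min_add_add_left, min_comm, Pi.zero_apply, add_zero]
  rw [hinf, hDf]
  exact hω.dirichletIntegral_add_inf_zero_le ha hea

end IsOuter

theorem theorem2p4 (ω : ℂ → ℝ≥0∞) (hω : IsSuperharmonicWeight ω) (f g : ℂ → ℂ)
    (hf : IsOuter f) (hf2 : MemHardy 2 f) (hg : IsOuter g) (hg2 : MemHardy 2 g) :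
    dirichletIntegral ω (outerSup f g) ≤ dirichletIntegral ω f + dirichletIntegral ω g ∧
    dirichletIntegral ω (outerInf f g) ≤ dirichletIntegral ω f + dirichletIntegral ω g ∧
    dirichletIntegral ω (outerInf f (fun z => f z ^ 2)) ≤ 4 * dirichletIntegral ω f := by
  have hle := IsOuter.dirichletIntegral_outerSup_add_outerInf_le hω.superharmonic hf hf2 hg hg2
  exact ⟨le_self_add.trans hle, le_add_self.trans hle,
    IsOuter.dirichletIntegral_outerInf_sq_le hω.superharmonic hf hf2⟩
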